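/- Let $m\ge 1$. A (squarefree) monomial in $x_0,\dots,x_{m-1}$ is a product $f=\prod_{i\in \operatorname{ind}(f)}x_i$ with $\operatorname{ind}(f)\subseteq\{0,\dots,m-1\}$ and $\deg f=|\operatorname{ind}(f)|$. Write $f\preceq g$ if $g$ has a divisor $g^*$ of the same degree $s$ as $f$ such that $i_\ell\le j_\ell$ for all $\ell$, where $f=x_{i_1}\cdots x_{i_s}$, $i_1<\dots<i_s$, and $g^*=x_{j_1}\cdots x_{j_s}$, $j_1<\dots<j_s$. A set $\mathcal I$ of monomials is decreasing if $f\in\mathcal I$ and $g\preceq f$ imply $g\in\mathcal I$. Put $\mathcal I_d=\{f\in\mathcal I:\deg f=d\}$, and let $\mathcal C(\mathcal I)\subseteq\mathbb F_2^{2^m}$ be the span of the evaluation vectors $\operatorname{ev}(f)=(f(x))_{x\in\mathbb F_2^m}$, $f\in\mathcal I$. For a monomial $f$ and a divisor $g$ of $f$ let $|\lambda_f(g)|=\sum_{i\in\operatorname{ind}(g)}|\{j<i: j\notin\operatorname{ind}(f)\}|$ and $|\lambda_f|=|\lambda_f(f)|$. For two coprime monomials $f,g$ of degree $2$ let $\alpha_{f,g}=2$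 if $f,g$ are not comparable for $\preceq$; if they are comparable, let $\alpha_{f,g}=0$ if all indices of one are smaller than all indices of the other, and $\alpha_{f,g}=1$ otherwise. Let $\mathcal I$ be a decreasing monomial set, let $r=\max_{f\in\mathcal I}\deg f$, and assume $r\ge 2$. A word is of Type II if it is $\operatorname{ev}(P)$ for some $$P=y_1\cdots y_{r-2}\,(y_{r-1}y_r+y_{r+1}y_{r+2}+\dots+y_{r+2\nu-3}y_{r+2\nu-2}),\qquad 2\le 2\nu\le m-r+2,$$ where the $y_i$ are affine forms over $\mathbb F_2$ in $x_0,\dots,x_{m-1}$ whose linear parts are linearly independent. **Theorem.** Let $2\le 2\mu\le m-r+2$ and $w_\mu=2^{m+1-r}-2^{m+1-r-\mu}$, and let $N_\mu$ be the number of Type II codewords of Hamming weight $w_\mu$ in $\mathcal C(\mathcal I)$. (a) If $\mu\ge 2$, then $$N_\mu=\sum_{h,\{f_1,\dots,f_\mu\}}\frac{2^{\,r-2+2\mu+|\lambda_h|+\sum_{i=1}^{\mu}|\lambda_{f_i}(f_i/h)|}}{2^{\,\sum_{1\le i<j\le\mu}\alpha_{f_i/h,\,f_j/h}}},$$ where the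 sum is over all $h\in\mathcal I_{r-2}$ and all sets of $\mu$ distinct monomials $f_1,\dots,f_\mu\in\mathcal I_r$ such that $\gcd(f_i,f_j)=h$ for all $i\ne j$. (b) If $\mu=1$ (no pairs, so that no $h$ is determined), then $N_1=\sum_{f\in\mathcal I_r}2^{\,r+|\lambda_f|}$. -/

import Mathlib

namespace PolarCode

/-- A squarefree monomial `x_{i_1} ⋯ x_{i_s}` in `x_0, …, x_{m-1}`, represented by its support
`ind(f) = {i_1, …, i_s}`. So `f.card` is the degree, `f ∩ g` is `gcd(f, g)`, `f ⊆ g` is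
divisibility, and `f \ h` is `f / h` for `h` dividing `f`. -/
abbrev Monomial (m : ℕ) := Finset (Fin m)

/-- The words of length `2 ^ m` over `𝔽₂`, with coordinates indexed by the points of `𝔽₂ ^ m`. -/
abbrev Word (m : ℕ) := (Fin m → ZMod 2) → ZMod 2

/-- The monomial as a polynomial. -/
noncomputable def Monomial.toPoly {m : ℕ} (f : Monomial m) : MvPolynomial (Fin m) (ZMod 2) :=
  ∏ i ∈ f, MvPolynomial.X i

/-- The evaluation word of a polynomial. Two polynomials have the same word if and only if they
agree modulo the relations `x_i ^ 2 = x_i`. -/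
noncomputable def ev {m : ℕ} (P : MvPolynomial (Fin m) (ZMod 2)) : Word m :=
  fun x => MvPolynomial.eval x P

/-- The monomial code `𝒞(ℐ)`. -/
noncomputable def code {m : ℕ} (I : Finset (Monomial m)) : Submodule (ZMod 2) (Word m) :=
  Submodule.span (ZMod 2) ((fun f => ev (Monomial.toPoly f)) '' (I : Set (Monomial m)))

/-- `f ⪯_sh g`: the degrees agree and `i_ℓ ≤ j_ℓ` for all `ℓ`, where `i_1 < i_2 < ⋯` and
`j_1 < j_2 < ⋯` are the indices of the variables of `f` and of `g`. -/
def ShiftLE {m : ℕ} (f g : Monomial m) : Prop :=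
  ∃ h : f.card = g.card, ∀ l : Fin f.card, f.orderEmbOfFin rfl l ≤ g.orderEmbOfFin h.symm l

/-- `f ⪯ g`: there is a monomial `g'` with `f ⪯_sh g'` and `g' ∣ g`. -/
def PrecEq {m : ℕ} (f g : Monomial m) : Prop :=
  ∃ g' : Monomial m, ShiftLE f g' ∧ g' ⊆ g

/-- Decreasing monomial sets. -/
def IsDecreasing {m : ℕ} (I : Finset (Monomial m)) : Prop :=
  ∀ f ∈ I, ∀ g : Monomial m, PrecEq g f → g ∈ I

/-- `ℐ_d`, the monomials of degree `d` in `ℐ`. -/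
def degPart {m : ℕ} (I : Finset (Monomial m)) (d : ℕ) : Finset (Monomial m) :=
  I.filter (fun f => f.card = d)

/-- `λ_f(x_i)`, the number of `j < i` with `j ∉ ind(f)`. -/
def lambdaVar {m : ℕ} (f : Monomial m) (i : Fin m) : ℕ :=
  (Finset.univ.filter (fun j : Fin m => j < i ∧ j ∉ f)).card

/-- `|λ_f(g)| = ∑ λ_f(x_i)` over `i ∈ ind(g)`, for `g ∣ f`. -/
def lambdaSize {m : ℕ} (f g : Monomial m) : ℕ :=
  ∑ i ∈ g, lambdaVar f i

open Classical in
/-- The collision exponent `α_{f,g}` of two coprime monomials of degree two: `2` if they are not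
comparable for `⪯`; if they are comparable, `0` if all indices of one of them lie below all
indices of the other, and `1` otherwise. -/
noncomputable def alpha {m : ℕ} (f g : Monomial m) : ℕ :=
  if ¬ PrecEq f g ∧ ¬ PrecEq g f then 2
  else if (∀ a ∈ f, ∀ b ∈ g, b < a) ∨ (∀ a ∈ f, ∀ b ∈ g, a < b) then 0
  else 1

theorem alpha_comm {m : ℕ} (f g : Monomial m) : alpha f g = alpha g f := by
  have h1 : (¬ PrecEq f g ∧ ¬ PrecEq g f) ↔ (¬ PrecEq g f ∧ ¬ PrecEq f g) := and_comm
  have h2 : ((∀ a ∈ f, ∀ b ∈ g, b < a) ∨ (∀ a ∈ f, ∀ b ∈ g, a < b)) ↔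
      ((∀ a ∈ g, ∀ b ∈ f, b < a) ∨ (∀ a ∈ g, ∀ b ∈ f, a < b)) := by
    constructor
    · rintro (h | h)
      · exact Or.inr fun a ha b hb => h b hb a ha
      · exact Or.inl fun a ha b hb => h b hb a ha
    · rintro (h | h)
      · exact Or.inr fun a ha b hb => h b hb a ha
      · exact Or.inl fun a ha b hb => h b hb a ha
  unfold alpha
  classical
  exact if_congr h1 rfl (if_congr h2 rfl rfl)

/-- `α_{f/h, g/h}` for an unordered pair `{f, g}`. -/
noncomputable def alphaPair {m : ℕ} (h : Monomial m) (p : Sym2 (Monomial m)) : ℕ :=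
  Sym2.lift ⟨fun f g => alpha (f \ h) (g \ h), fun _ _ => alpha_comm _ _⟩ p

/-- The sum of `α_{f/h, g/h}` over the unordered pairs `{f, g}` of distinct elements of `F`. -/
noncomputable def alphaSum {m : ℕ} (h : Monomial m) (F : Finset (Monomial m)) : ℕ :=
  ∑ p ∈ F.sym2 with ¬ p.IsDiag, alphaPair h p

/-- The affine form `∑ a_j x_j + ε`. -/
noncomputable def affineForm {m : ℕ} (a : Fin m → ZMod 2) (e : ZMod 2) :
    MvPolynomial (Fin m) (ZMod 2) :=
  ∑ j, MvPolynomial.C (a j) * MvPolynomial.X j + MvPolynomial.C e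

/-- `c` is the evaluation of
`y_1 ⋯ y_{r-2} (y_{r-1} y_r + y_{r+1} y_{r+2} + ⋯ + y_{r+2μ-3} y_{r+2μ-2})`,
where the `y`'s are affine forms whose linear parts are linearly independent. The first `r - 2`
forms are indexed by `Fin (r - 2)`, the two forms of the `j`-th product by `(j, 0)`, `(j, 1)`. -/
def IsTypeIIWith {m : ℕ} (r μ : ℕ) (c : Word m) : Prop :=
  ∃ (a : Fin (r - 2) ⊕ (Fin μ × Fin 2) → (Fin m → ZMod 2))
    (e : Fin (r - 2) ⊕ (Fin μ × Fin 2) → ZMod 2),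
    LinearIndependent (ZMod 2) a ∧
    c = ev ((∏ i : Fin (r - 2), affineForm (a (Sum.inl i)) (e (Sum.inl i))) *
      ∑ j : Fin μ, affineForm (a (Sum.inr (j, 0))) (e (Sum.inr (j, 0))) *
        affineForm (a (Sum.inr (j, 1))) (e (Sum.inr (j, 1))))

/-- Type II words with respect to the degree `r ≥ 2`. -/
def IsTypeII {m : ℕ} (r : ℕ) (c : Word m) : Prop :=
  ∃ μ : ℕ, 2 ≤ 2 * μ ∧ 2 * μ ≤ m - r + 2 ∧ IsTypeIIWith r μ c

/-- The codewords of Type II and of Hamming weight `w` in `𝒞(ℐ)`. -/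
def typeIICodewords {m : ℕ} (I : Finset (Monomial m)) (r w : ℕ) : Set (Word m) :=
  {c | c ∈ code I ∧ hammingNorm c = w ∧ IsTypeII r c}

open Classical in
/-- The `μ`-element sets of monomials in `ℐ_r` any two distinct members of which have gcd `h`. -/
noncomputable def tuplesWithGcd {m : ℕ} (I : Finset (Monomial m)) (r μ : ℕ) (h : Monomial m) :
    Finset (Finset (Monomial m)) :=
  ((degPart I r).powersetCard μ).filter (fun F => ∀ f ∈ F, ∀ g ∈ F, f ≠ g → f ∩ g = h)

end PolarCode

/-!
Write `mono f` for the word of a monomial `f`, and call the map `x ↦ x + p(x)` a shear with pivot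
set `h` if `p_l` is, for `l ∈ h`, an affine form in the variables below `x_l` outside `h`, and
`p_l = 0` for `l ∉ h`. A shear is a lower triangular affine involution, so it preserves a
decreasing monomial code (`comp_shearMap_mem_code_iff`), and by Gaussian elimination every flat is
the flat `x_l = 1`, `l ∈ h`, moved by a unique shear (`exists_echelon`, `shear_unique`). There are
`2 ^ (|h| + |λ_h|)` shears with pivot set `h` (`card_shears`).

A Type II codeword lives on the flat of codimension `r - 2` cut out by its linear factors, hence
is `mono h * q`, moved by a shear, where `h` has degree `r - 2`, `q` does not involve the
variables of `h`, and all monomials of `q` lie in the link `{t : t coprime to h, h t ∈ I}`. This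
link is a decreasing set of monomials of degree at most two. The weight of the word says that the
sum of the signs `(-1) ^ q(x)` is `2 ^ (m - μ)` (`hammingNorm_flat_word_iff`). Conversely, such a
`q` is a sum of `μ` products of independent affine forms (`exists_hyperbolic_form`), so that the
word is of Type II. For `μ ≥ 2` the support of `q` spans the space affinely
(`isNondegenerate_of_signSum`), so `h`, the shear and `q` are determined by the word
(`flat_word_unique`). For `μ = 1` the words are the indicators of flats of codimension `r`, which
gives the second formula directly.

It remains to count the words `q`. Let `x_b` be the last variable. Either `q` does not involve it,
or `q = (x_a + z) (x_b + w) + q'`, where `x_a` is the leading variable of the coefficient of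
`x_b`, the pair `x_a x_b` lies in the family, `z` is any affine form in the variables below `x_a`,
`w` any affine form in the variables other than `x_a`, `x_b`, and `q'` is of the same kind in
these variables with `μ - 1` in place of `μ` (`exists_split`, `card_hyperbolicWords_succ`). The
sum over matchings obeys the same recursion (`sum_matchings_succ`): when `x_a` is removed, the
exponent of another pair `t` drops by the number of variables of `t` above `x_a`, and since `x_b`
is last, this number is the collision exponent of `x_a x_b` and `t` (`alpha_pair`).
-/

namespace PolarCode

/-! ### Words, monomials and the code on one coordinate less -/

/-- The evaluation word of a monomial. -/
def mono {m : ℕ} (f : Monomial m) : Word m := fun x => ∏ i ∈ f, x i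

lemma ev_toPoly {m : ℕ} (f : Monomial m) : ev (Monomial.toPoly f) = mono f := by
  funext x
  simp [ev, Monomial.toPoly, mono, map_prod]

lemma code_eq_span {m : ℕ} (I : Finset (Monomial m)) :
    code I = Submodule.span (ZMod 2) (mono '' (I : Set (Monomial m))) := by
  unfold code
  simp only [ev_toPoly]

lemma mono_mem_code {m : ℕ} {I : Finset (Monomial m)} {f : Monomial m} (hf : f ∈ I) :
    mono f ∈ code I := by
  rw [code_eq_span]
  exact Submodule.subset_span ⟨f, hf, rfl⟩

lemma code_le {m : ℕ} {I : Finset (Monomial m)} {M : Submodule (ZMod 2) (Word m)}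
    (h : ∀ f ∈ I, mono f ∈ M) : code I ≤ M := by
  rw [code_eq_span, Submodule.span_le]
  rintro _ ⟨f, hf, rfl⟩
  exact h f hf

lemma code_mono {m : ℕ} {I J : Finset (Monomial m)} (h : I ⊆ J) : code I ≤ code J :=
  code_le fun _ hf => mono_mem_code (h hf)

lemma zmod2_cases (a : ZMod 2) : a = 0 ∨ a = 1 := by
  revert a; decide

lemma zmod2_mul_self (a : ZMod 2) : a * a = a := by
  revert a; decide

lemma zmod2_ne_one {a : ZMod 2} : a ≠ 1 ↔ a = 0 := by
  revert a; decide

lemma pi_add_self {α : Type*} (c : α → ZMod 2) : c + c = 0 :=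
  funext fun _ => CharTwo.add_self_eq_zero _

lemma pi_add_cancel_left {α : Type*} (c d : α → ZMod 2) : c + (c + d) = d := by
  rw [← add_assoc, pi_add_self, zero_add]

lemma mono_mul_mono {m : ℕ} (f g : Monomial m) : mono f * mono g = mono (f ∪ g) := by
  funext x
  simp only [mono, Pi.mul_apply]
  rw [← Finset.prod_union_inter, ← Finset.prod_sdiff
    (Finset.inter_subset_left.trans Finset.subset_union_left : f ∩ g ⊆ f ∪ g), mul_assoc,
    ← Finset.prod_mul_distrib]
  simp only [zmod2_mul_self]

lemma mono_empty {m : ℕ} : mono (∅ : Monomial m) = 1 := by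
  funext x; simp [mono]

lemma mono_singleton {m : ℕ} (i : Fin m) : mono {i} = fun x => x i := by
  funext x; simp [mono]

lemma mul_mem_code {m : ℕ} {A B C : Finset (Monomial m)}
    (h : ∀ f ∈ A, ∀ g ∈ B, f ∪ g ∈ C) {c d : Word m} (hc : c ∈ code A) (hd : d ∈ code B) :
    c * d ∈ code C := by
  have h1 : code A ≤ (code C).comap (LinearMap.mulRight (ZMod 2) d) := by
    refine code_le fun f hf => ?_
    have h2 : code B ≤ (code C).comap (LinearMap.mulLeft (ZMod 2) (mono f)) := by
      refine code_le fun g hg => ?_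
      simp only [Submodule.mem_comap, LinearMap.mulLeft_apply, mono_mul_mono]
      exact mono_mem_code (h f hf g hg)
    exact h2 hd
  exact h1 hc

/-- The derivative of a word in the direction of the `b`-th coordinate, that is, the coefficient
of `x_b`. -/
def slope {m : ℕ} (b : Fin m) : Word m →ₗ[ZMod 2] Word m where
  toFun c x := c (Function.update x b 1) + c (Function.update x b 0)
  map_add' c d := by funext x; simp only [Pi.add_apply]; ring
  map_smul' k c := by
    funext x; simp only [Pi.smul_apply, smul_eq_mul, RingHom.id_apply]; ring

/-- The restriction of a word to `x_b = 0`, as a word that does not depend on `x_b`. -/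
def restrictZero {m : ℕ} (b : Fin m) : Word m →ₗ[ZMod 2] Word m where
  toFun c x := c (Function.update x b 0)
  map_add' _ _ := rfl
  map_smul' _ _ := rfl

lemma slope_apply {m : ℕ} (b : Fin m) (c : Word m) (x : Fin m → ZMod 2) :
    slope b c x = c (Function.update x b 1) + c (Function.update x b 0) := rfl

lemma restrictZero_apply {m : ℕ} (b : Fin m) (c : Word m) (x : Fin m → ZMod 2) :
    restrictZero b c x = c (Function.update x b 0) := rfl

lemma eq_slope_add {m : ℕ} (b : Fin m) (c : Word m) :
    c = (fun x => x b) * slope b c + restrictZero b c := by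
  funext x
  simp only [Pi.add_apply, Pi.mul_apply, slope_apply, restrictZero_apply]
  rcases zmod2_cases (x b) with h | h
  · rw [h, zero_mul, zero_add]
    conv_lhs => rw [← Function.update_eq_self b x, h]
  · rw [h, one_mul, add_assoc, CharTwo.add_self_eq_zero, add_zero]
    conv_lhs => rw [← Function.update_eq_self b x, h]

lemma mono_update_of_notMem {m : ℕ} {b : Fin m} {f : Monomial m} (hb : b ∉ f)
    (x : Fin m → ZMod 2) (v : ZMod 2) : mono f (Function.update x b v) = mono f x := by
  refine Finset.prod_congr rfl fun i hi => ?_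
  rw [Function.update_of_ne]
  rintro rfl
  exact hb hi

lemma mono_update_of_mem {m : ℕ} {b : Fin m} {f : Monomial m} (hb : b ∈ f)
    (x : Fin m → ZMod 2) (v : ZMod 2) :
    mono f (Function.update x b v) = v * mono (f.erase b) x := by
  rw [← mono_update_of_notMem (Finset.notMem_erase b f) x v]
  simp only [mono]
  rw [← Finset.mul_prod_erase f _ hb, Function.update_self]

lemma slope_mono_of_mem {m : ℕ} {b : Fin m} {f : Monomial m} (hb : b ∈ f) :
    slope b (mono f) = mono (f.erase b) := by
  funext x
  rw [slope_apply, mono_update_of_mem hb, mono_update_of_mem hb]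
  ring

lemma slope_mono_of_notMem {m : ℕ} {b : Fin m} {f : Monomial m} (hb : b ∉ f) :
    slope b (mono f) = 0 := by
  funext x
  rw [slope_apply, mono_update_of_notMem hb, mono_update_of_notMem hb]
  exact CharTwo.add_self_eq_zero _

lemma restrictZero_mono_of_mem {m : ℕ} {b : Fin m} {f : Monomial m} (hb : b ∈ f) :
    restrictZero b (mono f) = 0 := by
  funext x
  rw [restrictZero_apply, mono_update_of_mem hb, zero_mul]
  rfl

lemma restrictZero_mono_of_notMem {m : ℕ} {b : Fin m} {f : Monomial m} (hb : b ∉ f) :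
    restrictZero b (mono f) = mono f := by
  funext x
  rw [restrictZero_apply, mono_update_of_notMem hb]

/-- The monomials `t` coprime to `h` with `h * t` in `I`. -/
def link {m : ℕ} (I : Finset (Monomial m)) (h : Monomial m) : Finset (Monomial m) :=
  Finset.univ.filter fun t => Disjoint h t ∧ h ∪ t ∈ I

lemma mem_link {m : ℕ} {I : Finset (Monomial m)} {h t : Monomial m} :
    t ∈ link I h ↔ Disjoint h t ∧ h ∪ t ∈ I := by
  simp [link]

lemma slope_mem_code {m : ℕ} {I : Finset (Monomial m)} {c : Word m} (hc : c ∈ code I)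
    (b : Fin m) : slope b c ∈ code (link I {b}) := by
  have h : code I ≤ (code (link I {b})).comap (slope b) := by
    refine code_le fun f hf => ?_
    by_cases hb : b ∈ f
    · rw [Submodule.mem_comap, slope_mono_of_mem hb]
      refine mono_mem_code (mem_link.2 ⟨by simp, ?_⟩)
      rwa [← Finset.insert_eq, Finset.insert_erase hb]
    · rw [Submodule.mem_comap, slope_mono_of_notMem hb]
      exact zero_mem _
  exact h hc

lemma restrictZero_mem_code {m : ℕ} {I : Finset (Monomial m)} {c : Word m} (hc : c ∈ code I)
    (b : Fin m) : restrictZero b c ∈ code (I.filter (b ∉ ·)) := by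
  have h : code I ≤ (code (I.filter (b ∉ ·))).comap (restrictZero b) := by
    refine code_le fun f hf => ?_
    by_cases hb : b ∈ f
    · rw [Submodule.mem_comap, restrictZero_mono_of_mem hb]
      exact zero_mem _
    · rw [Submodule.mem_comap, restrictZero_mono_of_notMem hb]
      exact mono_mem_code (by simp [hf, hb])
  exact h hc

lemma mono_mul_mem_code {m : ℕ} {I : Finset (Monomial m)} {h : Monomial m} {q : Word m}
    (hq : q ∈ code (link I h)) : mono h * q ∈ code I := by
  refine mul_mem_code (A := {h}) (B := link I h) ?_ (mono_mem_code (by simp)) hq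
  intro f hf g hg
  rw [Finset.mem_singleton] at hf
  subst hf
  exact (mem_link.1 hg).2

lemma link_link {m : ℕ} (I : Finset (Monomial m)) {b : Fin m} {h : Monomial m} (hb : b ∉ h) :
    link (link I {b}) h = link I (insert b h) := by
  ext t
  simp only [mem_link, Finset.disjoint_insert_left, Finset.disjoint_singleton_left,
    Finset.mem_union, ← Finset.insert_eq, Finset.insert_union]
  tauto

lemma update_eq_of_dependsOn {m : ℕ} {c : Word m} {s : Set (Fin m)} (hc : DependsOn c s)
    {b : Fin m} (hb : b ∉ s) (x : Fin m → ZMod 2) (v : ZMod 2) :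
    c (Function.update x b v) = c x := by
  refine hc fun i hi => ?_
  rw [Function.update_of_ne]
  rintro rfl
  exact hb hi

lemma slope_mul_of_dependsOn {m : ℕ} {c : Word m} {s : Set (Fin m)} (hc : DependsOn c s)
    {b : Fin m} (hb : b ∉ s) (d : Word m) : slope b (d * c) = slope b d * c := by
  funext x
  simp only [slope_apply, Pi.mul_apply, update_eq_of_dependsOn hc hb]
  ring

lemma slope_eq_zero_of_dependsOn {m : ℕ} {c : Word m} {s : Set (Fin m)} (hc : DependsOn c s)
    {b : Fin m} (hb : b ∉ s) : slope b c = 0 := by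
  funext x
  simp only [slope_apply, update_eq_of_dependsOn hc hb]
  exact CharTwo.add_self_eq_zero _

/-- Conversely to `mono_mul_mem_code`: differentiating `mono h * q` along all variables of `h`
recovers `q`. -/
lemma mem_code_link {m : ℕ} {h : Monomial m} {q : Word m}
    (hq : DependsOn q ((h : Set (Fin m))ᶜ)) : ∀ {I : Finset (Monomial m)},
    mono h * q ∈ code I → q ∈ code (link I h) := by
  induction h using Finset.induction_on with
  | empty =>
    intro I hI
    rw [mono_empty, one_mul] at hI
    refine code_mono (fun t ht => ?_) hI
    simp [mem_link, ht]
  | insert b h hb ih =>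
    intro I hI
    have hq' : DependsOn q ((h : Set (Fin m))ᶜ) := by
      intro x y hxy
      refine hq fun i hi => hxy i ?_
      simp only [Finset.coe_insert, Set.mem_compl_iff, Set.mem_insert_iff, not_or] at hi
      exact hi.2
    have h1 := slope_mem_code hI b
    rw [slope_mul_of_dependsOn hq (by simp), slope_mono_of_mem (Finset.mem_insert_self b h),
      Finset.erase_insert hb] at h1
    rw [← link_link I hb]
    exact ih hq' h1

lemma dependsOn_of_mem_code {m : ℕ} {I : Finset (Monomial m)} {T : Finset (Fin m)}
    (hI : ∀ f ∈ I, f ⊆ T) {c : Word m} (hc : c ∈ code I) : DependsOn c (T : Set (Fin m)) := by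
  intro x y hxy
  rw [code_eq_span] at hc
  induction hc using Submodule.span_induction with
  | mem c hc =>
    obtain ⟨f, hf, rfl⟩ := hc
    exact Finset.prod_congr rfl fun i hi => hxy i (hI f hf hi)
  | zero => rfl
  | add c d _ _ h1 h2 => simp [h1, h2]
  | smul k c _ h1 => simp [h1]

lemma eq_zero_of_mem_code_empty {m : ℕ} {c : Word m} (hc : c ∈ code (∅ : Finset (Monomial m))) :
    c = 0 := by
  simpa [code_eq_span] using hc

lemma nonempty_of_mem_code {m : ℕ} {I : Finset (Monomial m)} {c : Word m} (hc : c ∈ code I)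
    (h : c ≠ 0) : I.Nonempty := by
  by_contra hI
  rw [Finset.not_nonempty_iff_eq_empty] at hI
  subst hI
  exact h (eq_zero_of_mem_code_empty hc)

/-- Monomials are linearly independent as functions: at the indicator vector of a monomial `f`
of least degree in a linear relation only `f` itself survives. -/
lemma linearIndependent_mono {m : ℕ} :
    LinearIndependent (ZMod 2) (mono : Monomial m → Word m) := by
  rw [Fintype.linearIndependent_iff]
  intro k hk
  suffices H : ∀ n (f : Monomial m), f.card = n → k f = 0 from fun f => H _ f rfl
  intro n
  induction n using Nat.strong_induction_on with
  | _ n ih =>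
    rintro f rfl
    have h := congrFun hk (fun i => if i ∈ f then 1 else 0)
    simp only [Finset.sum_apply, Pi.smul_apply, smul_eq_mul, Pi.zero_apply] at h
    rw [Finset.sum_eq_single f] at h
    · have h2 : mono f (fun i => if i ∈ f then (1 : ZMod 2) else 0) = 1 :=
        Finset.prod_eq_one fun i hi => by simp [hi]
      rwa [h2, mul_one] at h
    · intro g _ hgf
      by_cases hg : g ⊆ f
      · rw [ih g.card (Finset.card_lt_card (hg.ssubset_of_ne hgf)) g rfl, zero_mul]
      · obtain ⟨i, hi, hif⟩ := Finset.not_subset.1 hg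
        rw [mono, Finset.prod_eq_zero hi (by simp [hif]), mul_zero]
    · simp

lemma natCard_code {m : ℕ} (I : Finset (Monomial m)) : Nat.card (code I) = 2 ^ I.card := by
  have h1 : Module.finrank (ZMod 2) (code I) = I.card := by
    rw [code_eq_span, Set.image_eq_range]
    have h2 := finrank_span_eq_card
      (linearIndependent_mono.comp (fun f : I => (f : Monomial m)) Subtype.val_injective)
    rw [Fintype.card_coe] at h2
    exact h2
  rw [Module.natCard_eq_pow_finrank (K := ZMod 2), h1, Nat.card_zmod]

/-! ### The order on monomials by counting -/

/-- For every `i`, the monomial `g` has at most as many variables of index `≥ i` as `f`. This is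
the order `g ⪯ f` in a form that is easy to check under unions. -/
def Dominated {m : ℕ} (g f : Monomial m) : Prop :=
  ∀ i : Fin m, (g.filter (i ≤ ·)).card ≤ (f.filter (i ≤ ·)).card

lemma card_filter_insert_le {m : ℕ} (g : Monomial m) (j i : Fin m) :
    ((insert j g).filter (i ≤ ·)).card ≤ (g.filter (i ≤ ·)).card + if i ≤ j then 1 else 0 := by
  rw [Finset.filter_insert]
  split_ifs
  · exact Finset.card_insert_le _ _
  · simp

lemma card_filter_insert {m : ℕ} {g : Monomial m} {j : Fin m} (hj : j ∉ g) (i : Fin m) :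
    ((insert j g).filter (i ≤ ·)).card = (g.filter (i ≤ ·)).card + if i ≤ j then 1 else 0 := by
  rw [Finset.filter_insert]
  split_ifs
  · exact Finset.card_insert_of_notMem (by simp [hj])
  · simp

lemma Dominated.insert {m : ℕ} {g f : Monomial m} (h : Dominated g f) {j k : Fin m}
    (hjk : j ≤ k) (hk : k ∉ f) : Dominated (insert j g) (insert k f) := by
  intro i
  rw [card_filter_insert hk]
  refine (card_filter_insert_le g j i).trans (Nat.add_le_add (h i) ?_)
  split_ifs with h1 h2
  · rfl
  · exact absurd (h1.trans hjk) h2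
  · simp
  · rfl

lemma Dominated.of_subset {m : ℕ} {g f : Monomial m} (h : g ⊆ f) : Dominated g f :=
  fun _ => Finset.card_le_card (Finset.filter_subset_filter _ h)

lemma Dominated.trans {m : ℕ} {e g f : Monomial m} (h : Dominated e g) (h' : Dominated g f) :
    Dominated e f := fun i => (h i).trans (h' i)

lemma Dominated.union_left {m : ℕ} {g f h : Monomial m} (hgf : Dominated g f)
    (hf : Disjoint h f) : Dominated (h ∪ g) (h ∪ f) := by
  intro i
  rw [Finset.filter_union, Finset.filter_union,
    Finset.card_union_of_disjoint (Finset.disjoint_filter_filter hf)]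
  exact (Finset.card_union_le _ _).trans (Nat.add_le_add_left (hgf i) _)

lemma Dominated.card_le {m : ℕ} {g f : Monomial m} (h : Dominated g f) : g.card ≤ f.card := by
  rcases Nat.eq_zero_or_pos m with rfl | hm
  · rw [Finset.eq_empty_of_isEmpty g]
    simp
  · have h0 := h ⟨0, hm⟩
    rwa [Finset.filter_true_of_mem (fun x _ => Fin.le_def.2 (Nat.zero_le _)),
      Finset.filter_true_of_mem (fun x _ => Fin.le_def.2 (Nat.zero_le _))] at h0

lemma ShiftLE.dominated {m : ℕ} {g f : Monomial m} (h : ShiftLE g f) : Dominated g f := by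
  obtain ⟨hc, hle⟩ := h
  intro i
  refine Finset.card_le_card_of_injOn
    (fun x => if hx : x ∈ g then
      f.orderEmbOfFin hc.symm ((g.orderIsoOfFin rfl).symm ⟨x, hx⟩) else x) ?_ ?_
  · intro x hx
    simp only [Finset.coe_filter, Set.mem_ofPred_eq] at hx ⊢
    rw [dif_pos hx.1]
    refine ⟨Finset.orderEmbOfFin_mem _ _ _, hx.2.trans ?_⟩
    have h1 := hle ((g.orderIsoOfFin rfl).symm ⟨x, hx.1⟩)
    have h2 : g.orderEmbOfFin rfl ((g.orderIsoOfFin rfl).symm ⟨x, hx.1⟩) = x := by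
      rw [← Finset.coe_orderIsoOfFin_apply, OrderIso.apply_symm_apply]
    rwa [h2] at h1
  · intro x hx y hy hxy
    simp only [Finset.coe_filter, Set.mem_ofPred_eq] at hx hy
    simp only [dif_pos hx.1, dif_pos hy.1] at hxy
    have h1 := (f.orderEmbOfFin hc.symm).injective hxy
    have h2 := (g.orderIsoOfFin rfl).symm.injective h1
    exact congrArg Subtype.val h2

lemma Dominated.shiftLE {m : ℕ} {g f : Monomial m} (h : Dominated g f) (hc : g.card = f.card) :
    ShiftLE g f := by
  refine ⟨hc, fun l => ?_⟩
  by_contra hlt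
  rw [not_le] at hlt
  -- The entries of `g` from position `l` on outnumber those of `f` that are `≥ g_l`.
  have h1 := h (g.orderEmbOfFin rfl l)
  have h2 : (Finset.univ.filter (l ≤ ·)).card ≤
      (g.filter (g.orderEmbOfFin rfl l ≤ ·)).card := by
    refine Finset.card_le_card_of_injOn (g.orderEmbOfFin rfl) ?_
      (g.orderEmbOfFin rfl).injective.injOn
    intro x hx
    simp only [Finset.coe_filter, Finset.mem_univ, true_and, Set.mem_ofPred_eq] at hx ⊢
    exact ⟨Finset.orderEmbOfFin_mem _ _ _, by simpa using hx⟩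
  have h3 : (f.filter (g.orderEmbOfFin rfl l ≤ ·)).card ≤
      (Finset.univ.filter (l < ·)).card := by
    refine Finset.card_le_card_of_surjOn (f.orderEmbOfFin hc.symm) ?_
    intro x hx
    simp only [Finset.coe_filter, Set.mem_ofPred_eq] at hx
    have hxr : x ∈ Set.range (f.orderEmbOfFin hc.symm) := by
      rw [Finset.range_orderEmbOfFin]; exact hx.1
    obtain ⟨k, rfl⟩ := hxr
    refine ⟨k, ?_, rfl⟩
    simp only [Finset.coe_filter, Finset.mem_univ, true_and, Set.mem_ofPred_eq]
    exact (f.orderEmbOfFin hc.symm).lt_iff_lt.1 (hlt.trans_le hx.2)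
  have h4 : (Finset.univ.filter (l < ·)).card < (Finset.univ.filter (l ≤ ·)).card := by
    refine Finset.card_lt_card (Finset.ssubset_iff_of_subset ?_ |>.2 ⟨l, by simp, by simp⟩)
    intro x hx
    simp only [Finset.mem_filter, Finset.mem_univ, true_and] at hx ⊢
    exact hx.le
  omega

/-- Removing the least variables of `f` keeps the domination until the degrees agree. -/
lemma Dominated.precEq {m : ℕ} {g f : Monomial m} (h : Dominated g f) : PrecEq g f := by
  induction hn : f.card - g.card generalizing f with
  | zero =>
    have hc := h.card_le
    exact ⟨f, h.shiftLE (by omega), subset_rfl⟩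
  | succ n ih =>
    have hne : f.Nonempty := by
      rw [← Finset.card_pos]; omega
    have hd : Dominated g (f.erase (f.min' hne)) := by
      intro i
      by_cases hi : i ≤ f.min' hne
      · have h1 : ((f.erase (f.min' hne)).filter (i ≤ ·)) = f.erase (f.min' hne) :=
          Finset.filter_true_of_mem fun x hx =>
            hi.trans (Finset.min'_le _ _ (Finset.mem_of_mem_erase hx))
        rw [h1, Finset.card_erase_of_mem (Finset.min'_mem _ _)]
        have h2 : (g.filter (i ≤ ·)).card ≤ g.card := Finset.card_filter_le _ _
        omega
      · have h1 : ((f.erase (f.min' hne)).filter (i ≤ ·)) = f.filter (i ≤ ·) := by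
          rw [Finset.filter_erase, Finset.erase_eq_of_notMem]
          simp [hi]
        rw [h1]
        exact h i
    obtain ⟨g', h1, h2⟩ := ih hd (by
      rw [Finset.card_erase_of_mem (Finset.min'_mem _ _)]; omega)
    exact ⟨g', h1, h2.trans (Finset.erase_subset _ _)⟩

lemma precEq_iff_dominated {m : ℕ} {g f : Monomial m} : PrecEq g f ↔ Dominated g f :=
  ⟨fun ⟨_, h1, h2⟩ => h1.dominated.trans (.of_subset h2), Dominated.precEq⟩

lemma IsDecreasing.mem_of_dominated {m : ℕ} {I : Finset (Monomial m)} (hI : IsDecreasing I)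
    {f g : Monomial m} (hf : f ∈ I) (h : Dominated g f) : g ∈ I :=
  hI f hf g h.precEq

/-! ### Affine words -/

/-- Words that are affine functions. -/
def IsAffineWord {m : ℕ} (y : Word m) : Prop :=
  ∀ x u v, y (x + u + v) = y (x + u) + y (x + v) + y x

lemma IsAffineWord.add {m : ℕ} {y z : Word m} (hy : IsAffineWord y) (hz : IsAffineWord z) :
    IsAffineWord (y + z) := by
  intro x u v
  simp only [Pi.add_apply, hy x u v, hz x u v]
  ring

lemma isAffineWord_const {m : ℕ} (k : ZMod 2) : IsAffineWord (fun _ : Fin m → ZMod 2 => k) := by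
  intro x u v
  simp only
  rw [CharTwo.add_self_eq_zero, zero_add]

lemma isAffineWord_coord {m : ℕ} (i : Fin m) : IsAffineWord (fun x : Fin m → ZMod 2 => x i) := by
  intro x u v
  simp only [Pi.add_apply]
  rw [show x i + u i + (x i + v i) + x i = x i + u i + v i + (x i + x i) by ring,
    CharTwo.add_self_eq_zero, add_zero]

/-- Affine words are stable under affine changes of variables. -/
lemma IsAffineWord.comp {m n : ℕ} {y : Word m} (hy : IsAffineWord y)
    {φ : (Fin n → ZMod 2) → (Fin m → ZMod 2)} (hφ : ∀ i, IsAffineWord fun x => φ x i) :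
    IsAffineWord (fun x => y (φ x)) := by
  intro x u v
  have h1 : φ (x + u + v) = φ x + (φ (x + u) + φ x) + (φ (x + v) + φ x) := by
    rw [add_comm (φ (x + u)), pi_add_cancel_left]
    funext i
    refine (hφ i x u v).trans ?_
    simp only [Pi.add_apply]
    ring
  simp only [h1]
  rw [hy, add_comm (φ (x + u)), pi_add_cancel_left, add_comm (φ (x + v)), pi_add_cancel_left]

lemma IsAffineWord.eq_sum {m : ℕ} {y : Word m} (hy : IsAffineWord y) (x : Fin m → ZMod 2) :
    y x = y 0 + ∑ j, x j * (y (Pi.single j 1) + y 0) := by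
  let A : (Fin m → ZMod 2) →+ ZMod 2 :=
    { toFun := fun x => y x + y 0
      map_zero' := CharTwo.add_self_eq_zero _
      map_add' := fun u v => by
        have h := hy 0 u v
        simp only [zero_add] at h
        rw [h]
        ring }
  have h := LinearMap.pi_apply_eq_sum_univ (A.toZModLinearMap 2) x
  have h2 : ∀ i : Fin m, (fun j => if i = j then (1 : ZMod 2) else 0) = Pi.single i 1 := by
    intro i
    funext j
    simp [Pi.single_apply, eq_comm]
  simp only [AddMonoidHom.coe_toZModLinearMap, h2, smul_eq_mul] at h
  have h3 : y x + y 0 = ∑ j, x j * (y (Pi.single j 1) + y 0) := h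
  rw [← h3, add_comm (y x), ← add_assoc, CharTwo.add_self_eq_zero, zero_add]

/-- The monomials of degree at most one in the variables of `T`. -/
def affineMonomials {m : ℕ} (T : Finset (Fin m)) : Finset (Monomial m) :=
  insert ∅ (T.image fun i => {i})

lemma mem_affineMonomials {m : ℕ} {T : Finset (Fin m)} {f : Monomial m} :
    f ∈ affineMonomials T ↔ f ⊆ T ∧ f.card ≤ 1 := by
  simp only [affineMonomials, Finset.mem_insert, Finset.mem_image]
  constructor
  · rintro (rfl | ⟨i, hi, rfl⟩)
    · simp
    · simp [hi]
  · rintro ⟨h1, h2⟩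
    rcases f.eq_empty_or_nonempty with hf | ⟨i, hi⟩
    · exact Or.inl hf
    · refine Or.inr ⟨i, h1 hi, ?_⟩
      ext j
      simp only [Finset.mem_singleton]
      exact ⟨fun hj => hj ▸ hi, fun hj => Finset.card_le_one.1 h2 j hj i hi⟩

lemma card_affineMonomials {m : ℕ} (T : Finset (Fin m)) :
    (affineMonomials T).card = T.card + 1 := by
  rw [affineMonomials, Finset.card_insert_of_notMem (by simp),
    Finset.card_image_of_injective _ (Finset.singleton_injective)]

lemma affineMonomials_mono {m : ℕ} {T U : Finset (Fin m)} (h : T ⊆ U) :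
    affineMonomials T ⊆ affineMonomials U := fun f hf => by
  rw [mem_affineMonomials] at hf ⊢
  exact ⟨hf.1.trans h, hf.2⟩

lemma one_mem_affine {m : ℕ} (T : Finset (Fin m)) : (1 : Word m) ∈ code (affineMonomials T) := by
  rw [← mono_empty]
  exact mono_mem_code (by simp [mem_affineMonomials])

lemma coord_mem_affine {m : ℕ} {T : Finset (Fin m)} {i : Fin m} (hi : i ∈ T) :
    (fun x : Fin m → ZMod 2 => x i) ∈ code (affineMonomials T) := by
  rw [← mono_singleton]
  exact mono_mem_code (by simp [mem_affineMonomials, hi])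

lemma isAffineWord_of_mem {m : ℕ} {T : Finset (Fin m)} {y : Word m}
    (hy : y ∈ code (affineMonomials T)) : IsAffineWord y := by
  rw [code_eq_span] at hy
  induction hy using Submodule.span_induction with
  | mem c hc =>
    obtain ⟨f, hf, rfl⟩ := hc
    simp only [affineMonomials, Finset.coe_insert, Finset.coe_image, Set.mem_insert_iff,
      Set.mem_image] at hf
    rcases hf with rfl | ⟨i, _, rfl⟩
    · rw [mono_empty]; exact isAffineWord_const 1
    · rw [mono_singleton]; exact isAffineWord_coord i
  | zero => exact isAffineWord_const 0
  | add c d _ _ h1 h2 => exact h1.add h2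
  | smul k c _ h1 =>
    intro x u v
    simp only [Pi.smul_apply, smul_eq_mul, h1 x u v]
    ring

lemma dependsOn_of_mem_affine {m : ℕ} {T : Finset (Fin m)} {y : Word m}
    (hy : y ∈ code (affineMonomials T)) : DependsOn y (T : Set (Fin m)) :=
  dependsOn_of_mem_code (fun _ hf => (mem_affineMonomials.1 hf).1) hy

lemma IsAffineWord.mem_of_coeff {m : ℕ} {T : Finset (Fin m)} {y : Word m} (hy : IsAffineWord y)
    (hT : ∀ j, j ∉ T → y (Pi.single j 1) = y 0) : y ∈ code (affineMonomials T) := by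
  have h : y = y 0 • (1 : Word m) +
      ∑ j ∈ T, (y (Pi.single j 1) + y 0) • fun x : Fin m → ZMod 2 => x j := by
    funext x
    rw [hy.eq_sum x]
    simp only [Pi.add_apply, Pi.smul_apply, Pi.one_apply, smul_eq_mul, mul_one,
      Finset.sum_apply]
    congr 1
    rw [← Finset.sum_subset (Finset.subset_univ T)]
    · exact Finset.sum_congr rfl fun j _ => mul_comm _ _
    · intro j _ hj
      rw [hT j hj, CharTwo.add_self_eq_zero, mul_zero]
  rw [h]
  refine add_mem (Submodule.smul_mem _ _ (one_mem_affine T)) (sum_mem fun j hj => ?_)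
  exact Submodule.smul_mem _ _ (coord_mem_affine hj)

lemma IsAffineWord.mem_of_dependsOn {m : ℕ} {T : Finset (Fin m)} {y : Word m}
    (hy : IsAffineWord y) (hT : DependsOn y (T : Set (Fin m))) : y ∈ code (affineMonomials T) := by
  refine hy.mem_of_coeff fun j hj => hT fun i hi => ?_
  rw [Pi.single_eq_of_ne, Pi.zero_apply]
  rintro rfl
  exact hj hi

lemma IsAffineWord.mem_univ {m : ℕ} {y : Word m} (hy : IsAffineWord y) :
    y ∈ code (affineMonomials Finset.univ) :=
  hy.mem_of_coeff fun j hj => absurd (Finset.mem_univ j) hj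

/-- A non-constant affine word has a leading variable. -/
lemma exists_lead {m : ℕ} {T : Finset (Fin m)} {y : Word m} (hy : y ∈ code (affineMonomials T))
    (hne : ∃ x, y x ≠ y 0) : ∃ a ∈ T, ∃ z ∈ code (affineMonomials (T.filter (· < a))),
      y = (fun x => x a) + z := by
  have haff := isAffineWord_of_mem hy
  have hdep := dependsOn_of_mem_affine hy
  have hsup : ∀ j, y (Pi.single j 1) ≠ y 0 → j ∈ T := by
    intro j hj
    by_contra hjT
    refine hj (hdep fun i hi => ?_)
    rw [Pi.single_eq_of_ne, Pi.zero_apply]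
    rintro rfl
    exact hjT hi
  set U := Finset.univ.filter fun j => y (Pi.single j 1) ≠ y 0 with hU
  have hUne : U.Nonempty := by
    by_contra h
    rw [Finset.not_nonempty_iff_eq_empty, Finset.filter_eq_empty_iff] at h
    obtain ⟨x, hx⟩ := hne
    refine hx ?_
    rw [haff.eq_sum x]
    have h0 : ∀ j ∈ Finset.univ, x j * (y (Pi.single j 1) + y 0) = 0 := by
      intro j hj
      rw [not_not.1 (h hj), CharTwo.add_self_eq_zero, mul_zero]
    rw [Finset.sum_eq_zero h0, add_zero]
  have hmem := Finset.max'_mem U hUne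
  set a := U.max' hUne with ha
  rw [hU, Finset.mem_filter] at hmem
  refine ⟨a, hsup a hmem.2, (fun x => x a) + y, ?_, ?_⟩
  · refine ((isAffineWord_coord a).add haff).mem_of_coeff fun j hj => ?_
    simp only [Pi.add_apply, Pi.zero_apply, zero_add]
    by_cases hja : j = a
    · rw [hja, Pi.single_eq_same]
      have h0 : ∀ p q : ZMod 2, p ≠ q → 1 + p = q := by decide
      exact h0 _ _ hmem.2
    · rw [Pi.single_eq_of_ne (Ne.symm hja), zero_add]
      by_contra hj1
      have hjU : j ∈ U := by simp [hU, hj1]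
      have hlt : j < a := lt_of_le_of_ne (Finset.le_max' U j hjU) hja
      exact hj (Finset.mem_filter.2 ⟨hsup j hj1, hlt⟩)
  · rw [pi_add_cancel_left]

/-- In a product over the variables of `f`, each `x_i` may be replaced by an affine form in the
variables up to `x_i` without leaving the span of the monomials below `f`. -/
lemma prod_affine_mem_code {m : ℕ} (f : Monomial m) (y : Fin m → Word m)
    (hy : ∀ i ∈ f, y i ∈ code (affineMonomials (Finset.univ.filter (· ≤ i))))
    {I : Finset (Monomial m)} (hI : ∀ g, Dominated g f → g ∈ I) : ∏ i ∈ f, y i ∈ code I := by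
  induction f using Finset.induction_on generalizing I with
  | empty =>
    rw [Finset.prod_empty, ← mono_empty]
    exact mono_mem_code (hI _ (.of_subset subset_rfl))
  | insert i f hi ih =>
    rw [Finset.prod_insert hi]
    classical
    refine mul_mem_code (B := Finset.univ.filter fun g => Dominated g f) ?_
      (hy i (Finset.mem_insert_self _ _))
      (ih (fun j hj => hy j (Finset.mem_insert_of_mem hj)) (by simp))
    intro e he g hg
    simp only [Finset.mem_filter, Finset.mem_univ, true_and] at hg
    simp only [affineMonomials, Finset.mem_insert, Finset.mem_image, Finset.mem_filter,
      Finset.mem_univ, true_and] at he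
    refine hI _ ?_
    rcases he with rfl | ⟨j, hj, rfl⟩
    · rw [Finset.empty_union]
      exact hg.trans (.of_subset (Finset.subset_insert _ _))
    · rw [← Finset.insert_eq]
      exact hg.insert hj hi

/-! ### Flats in echelon form -/

open Classical in
/-- The elements of `code I`, as a finite set. -/
noncomputable def codeFinset {m : ℕ} (I : Finset (Monomial m)) : Finset (Word m) :=
  Finset.univ.filter (· ∈ code I)

lemma mem_codeFinset {m : ℕ} {I : Finset (Monomial m)} {c : Word m} :
    c ∈ codeFinset I ↔ c ∈ code I := by
  simp [codeFinset]

lemma card_codeFinset {m : ℕ} (I : Finset (Monomial m)) :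
    (codeFinset I).card = 2 ^ I.card := by
  rw [← natCard_code I, ← Fintype.card_coe, ← Nat.card_eq_fintype_card]
  exact Nat.card_congr (Equiv.subtypeEquivRight fun c => mem_codeFinset)

/-- The variables below `x_l` that do not divide `h`. -/
def freeBelow {m : ℕ} (h : Monomial m) (l : Fin m) : Finset (Fin m) :=
  Finset.univ.filter fun j => j < l ∧ j ∉ h

lemma mem_freeBelow {m : ℕ} {h : Monomial m} {l j : Fin m} :
    j ∈ freeBelow h l ↔ j < l ∧ j ∉ h := by
  simp [freeBelow]

/-- The data of an echelon system with pivot set `h`: to each pivot `l ∈ h` an affine form in the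
non-pivot variables below `x_l`, and `0` to the other indices. The flat described by `p` is
`x_l + p_l(x) = 1` for `l ∈ h`. -/
noncomputable def shears {m : ℕ} (h : Monomial m) : Finset (Fin m → Word m) :=
  Fintype.piFinset fun l =>
    if l ∈ h then codeFinset (affineMonomials (freeBelow h l)) else {0}

lemma mem_shears {m : ℕ} {h : Monomial m} {p : Fin m → Word m} :
    p ∈ shears h ↔ (∀ l ∈ h, p l ∈ code (affineMonomials (freeBelow h l))) ∧
      ∀ l ∉ h, p l = 0 := by
  simp only [shears, Fintype.mem_piFinset]
  constructor
  · intro H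
    refine ⟨fun l hl => ?_, fun l hl => ?_⟩
    · have := H l
      rwa [if_pos hl, mem_codeFinset] at this
    · have := H l
      rwa [if_neg hl, Finset.mem_singleton] at this
  · rintro ⟨h1, h2⟩ l
    split_ifs with hl
    · exact mem_codeFinset.2 (h1 l hl)
    · exact Finset.mem_singleton.2 (h2 l hl)

lemma card_shears {m : ℕ} (h : Monomial m) :
    (shears h).card = 2 ^ (h.card + lambdaSize h h) := by
  have h1 : ∀ l, (if l ∈ h then codeFinset (affineMonomials (freeBelow h l)) else {0}).card =
      if l ∈ h then 2 ^ (lambdaVar h l + 1) else 1 := by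
    intro l
    split_ifs
    · rw [card_codeFinset, card_affineMonomials]
      rfl
    · exact Finset.card_singleton _
  rw [shears, Fintype.card_piFinset, Finset.prod_congr rfl fun l _ => h1 l,
    Finset.prod_ite_mem, Finset.univ_inter, Finset.prod_pow_eq_pow_sum, Finset.sum_add_distrib,
    lambdaSize, Finset.sum_const, smul_eq_mul, mul_one, add_comm]

/-- The affine change of variables `x ↦ x + p(x)`. -/
def shearMap {m : ℕ} (p : Fin m → Word m) (x : Fin m → ZMod 2) : Fin m → ZMod 2 :=
  fun l => x l + p l x

lemma shear_dependsOn {m : ℕ} {h : Monomial m} {p : Fin m → Word m} (hp : p ∈ shears h)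
    (l : Fin m) : DependsOn (p l) (freeBelow h l : Set (Fin m)) := by
  by_cases hl : l ∈ h
  · exact dependsOn_of_mem_affine ((mem_shears.1 hp).1 l hl)
  · rw [(mem_shears.1 hp).2 l hl]
    exact fun _ _ _ => rfl

lemma shear_congr {m : ℕ} {h : Monomial m} {p : Fin m → Word m} (hp : p ∈ shears h)
    {x y : Fin m → ZMod 2} (hxy : ∀ j, j ∉ h → x j = y j) (l : Fin m) : p l x = p l y :=
  shear_dependsOn hp l fun j hj => hxy j (mem_freeBelow.1 (Finset.mem_coe.1 hj)).2

lemma shearMap_of_notMem {m : ℕ} {h : Monomial m} {p : Fin m → Word m} (hp : p ∈ shears h)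
    (x : Fin m → ZMod 2) {j : Fin m} (hj : j ∉ h) : shearMap p x j = x j := by
  simp [shearMap, (mem_shears.1 hp).2 j hj]

lemma shearMap_shearMap {m : ℕ} {h : Monomial m} {p : Fin m → Word m} (hp : p ∈ shears h)
    (x : Fin m → ZMod 2) : shearMap p (shearMap p x) = x := by
  funext l
  have h1 : p l (shearMap p x) = p l x :=
    shear_congr hp (fun j hj => shearMap_of_notMem hp x hj) l
  change shearMap p x l + p l (shearMap p x) = x l
  rw [h1, shearMap, add_assoc, CharTwo.add_self_eq_zero, add_zero]

lemma shearMap_bijective {m : ℕ} {h : Monomial m} {p : Fin m → Word m} (hp : p ∈ shears h) :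
    Function.Bijective (shearMap p) :=
  Function.Involutive.bijective (shearMap_shearMap hp)

lemma isAffineWord_shear {m : ℕ} {h : Monomial m} {p : Fin m → Word m} (hp : p ∈ shears h)
    (l : Fin m) : IsAffineWord (p l) := by
  by_cases hl : l ∈ h
  · exact isAffineWord_of_mem ((mem_shears.1 hp).1 l hl)
  · rw [(mem_shears.1 hp).2 l hl]
    exact isAffineWord_const 0

lemma isAffineWord_shearMap {m : ℕ} {h : Monomial m} {p : Fin m → Word m} (hp : p ∈ shears h)
    (l : Fin m) : IsAffineWord fun x => shearMap p x l :=
  (isAffineWord_coord l).add (isAffineWord_shear hp l)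

/-- A decreasing monomial code is invariant under lower triangular affine maps. -/
lemma comp_shearMap_mem_code {m : ℕ} {I : Finset (Monomial m)} (hI : IsDecreasing I)
    {h : Monomial m} {p : Fin m → Word m} (hp : p ∈ shears h) {c : Word m} (hc : c ∈ code I) :
    c ∘ shearMap p ∈ code I := by
  have H : code I ≤ (code I).comap (LinearMap.funLeft (ZMod 2) (ZMod 2) (shearMap p)) := by
    refine code_le fun f hf => ?_
    rw [Submodule.mem_comap]
    have h1 : LinearMap.funLeft (ZMod 2) (ZMod 2) (shearMap p) (mono f) =
        ∏ i ∈ f, fun x : Fin m → ZMod 2 => shearMap p x i := by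
      funext x
      simp [LinearMap.funLeft_apply, mono]
    rw [h1]
    refine prod_affine_mem_code f _ (fun i _ => ?_) fun g hg => hI.mem_of_dominated hf hg
    refine (isAffineWord_shearMap hp i).mem_of_dependsOn fun x y hxy => ?_
    simp only [Finset.coe_filter, Finset.mem_univ, true_and, Set.mem_ofPred_eq] at hxy
    simp only [shearMap]
    rw [hxy i le_rfl, shear_dependsOn hp i fun j hj =>
      hxy j (mem_freeBelow.1 (Finset.mem_coe.1 hj)).1.le]
  exact H hc

lemma comp_shearMap_mem_code_iff {m : ℕ} {I : Finset (Monomial m)} (hI : IsDecreasing I)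
    {h : Monomial m} {p : Fin m → Word m} (hp : p ∈ shears h) {c : Word m} :
    c ∘ shearMap p ∈ code I ↔ c ∈ code I := by
  refine ⟨fun H => ?_, comp_shearMap_mem_code hI hp⟩
  have h1 := comp_shearMap_mem_code hI hp H
  have h2 : (c ∘ shearMap p) ∘ shearMap p = c := by
    funext x
    simp [shearMap_shearMap hp]
  rwa [h2] at h1

lemma mono_eq_one_iff {m : ℕ} {h : Monomial m} {x : Fin m → ZMod 2} :
    mono h x = 1 ↔ ∀ l ∈ h, x l = 1 := by
  constructor
  · intro H l hl
    by_contra hne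
    replace hne := zmod2_ne_one.1 hne
    rw [mono, Finset.prod_eq_zero hl hne] at H
    exact absurd H (by decide)
  · exact fun H => Finset.prod_eq_one H

/-- The point with coordinates `1` on `h` and those of `x` elsewhere. -/
def fillOne {m : ℕ} (h : Monomial m) (x : Fin m → ZMod 2) : Fin m → ZMod 2 :=
  fun i => if i ∈ h then 1 else x i

lemma fillOne_of_mem {m : ℕ} {h : Monomial m} (x : Fin m → ZMod 2) {i : Fin m} (hi : i ∈ h) :
    fillOne h x i = 1 := if_pos hi

lemma fillOne_of_notMem {m : ℕ} {h : Monomial m} (x : Fin m → ZMod 2) {i : Fin m}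
    (hi : i ∉ h) : fillOne h x i = x i := if_neg hi

lemma mono_fillOne {m : ℕ} (h : Monomial m) (x : Fin m → ZMod 2) : mono h (fillOne h x) = 1 :=
  mono_eq_one_iff.2 fun _ hl => fillOne_of_mem x hl

lemma fillOne_eq_self {m : ℕ} {h : Monomial m} {x : Fin m → ZMod 2} (hx : mono h x = 1) :
    fillOne h x = x := by
  funext i
  by_cases hi : i ∈ h
  · rw [fillOne_of_mem x hi, mono_eq_one_iff.1 hx i hi]
  · rw [fillOne_of_notMem x hi]

lemma isAffineWord_fillOne {m : ℕ} (h : Monomial m) (i : Fin m) :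
    IsAffineWord fun x => fillOne h x i := by
  by_cases hi : i ∈ h
  · simpa only [fillOne, if_pos hi] using isAffineWord_const 1
  · simpa only [fillOne, if_neg hi] using isAffineWord_coord i

/-- The pivots of a flat are the coordinates that are determined on it by the preceding ones, so a
flat contained in another one has at least the pivots of the larger flat. -/
lemma pivots_subset {m : ℕ} {h h' : Monomial m} {p p' : Fin m → Word m} (hp : p ∈ shears h)
    (hp' : p' ∈ shears h')
    (H : ∀ x, mono h' (shearMap p' x) = 1 → mono h (shearMap p x) = 1) : h ⊆ h' := by
  intro l hl
  by_contra hl'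
  -- Two points of the flat of `p'` that first differ in the coordinate `l`.
  have key : ∀ z : Fin m → ZMod 2, shearMap p' (fillOne h' z) l = z l ∧
      shearMap p' (fillOne h' z) l = 1 + p l (shearMap p' (fillOne h' z)) := by
    intro z
    constructor
    · rw [shearMap_of_notMem hp' _ hl', fillOne_of_notMem _ hl']
    · have h1 := H (shearMap p' (fillOne h' z))
        (by rw [shearMap_shearMap hp', mono_fillOne])
      have h2 := mono_eq_one_iff.1 h1 l hl
      rw [shearMap] at h2
      rw [← h2, add_assoc, CharTwo.add_self_eq_zero, add_zero]
  have h1 := key 0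
  have h2 := key (Pi.single l 1)
  have h3 : p l (shearMap p' (fillOne h' 0)) =
      p l (shearMap p' (fillOne h' (Pi.single l 1))) := by
    refine shear_dependsOn hp l fun j hj => ?_
    have hjl := (mem_freeBelow.1 (Finset.mem_coe.1 hj)).1
    have h4 : ∀ i, i < l → fillOne h' 0 i = fillOne h' (Pi.single l 1) i := by
      intro i hi
      simp [fillOne, Pi.single_eq_of_ne hi.ne]
    simp only [shearMap]
    rw [h4 j hjl, shear_dependsOn hp' j fun i hi =>
      h4 i ((mem_freeBelow.1 (Finset.mem_coe.1 hi)).1.trans hjl)]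
  have h4 := (h1.1.symm.trans h1.2).trans ((h3 ▸ h2.2.symm).trans h2.1)
  simp at h4

/-- The echelon form of a flat is unique. -/
lemma shear_unique {m : ℕ} {h h' : Monomial m} {p p' : Fin m → Word m} (hp : p ∈ shears h)
    (hp' : p' ∈ shears h')
    (H : ∀ x, mono h (shearMap p x) = 1 ↔ mono h' (shearMap p' x) = 1) : h = h' ∧ p = p' := by
  obtain rfl : h = h' := Finset.Subset.antisymm (pivots_subset hp hp' fun x => (H x).2)
    (pivots_subset hp' hp fun x => (H x).1)
  refine ⟨rfl, funext fun l => ?_⟩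
  by_cases hl : l ∈ h
  · funext x
    have h1 : mono h (shearMap p (shearMap p (fillOne h x))) = 1 := by
      rw [shearMap_shearMap hp, mono_fillOne]
    have h3 := mono_eq_one_iff.1 h1 l hl
    have h4 := mono_eq_one_iff.1 ((H _).1 h1) l hl
    rw [shearMap] at h3 h4
    have hx : ∀ j, j ∉ h → shearMap p (fillOne h x) j = x j := fun j hj => by
      rw [shearMap_of_notMem hp _ hj, fillOne_of_notMem _ hj]
    rw [shear_congr hp hx] at h3
    rw [shear_congr hp' hx] at h4
    exact add_left_cancel (h3.trans h4.symm)
  · rw [(mem_shears.1 hp).2 l hl, (mem_shears.1 hp').2 l hl]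

/-- Jointly surjective affine words; for affine forms this is linear independence of the linear
parts. -/
def IndepForms {m : ℕ} {ι : Type*} (Y : ι → Word m) : Prop :=
  (∀ i, IsAffineWord (Y i)) ∧ Function.Surjective fun x i => Y i x

/-- Gaussian elimination: a product of independent affine forms is the indicator of a flat in
echelon form. -/
lemma exists_echelon {m : ℕ} {ι : Type*} {Y : ι → Word m} (hY : IndepForms Y) (s : Finset ι) :
    ∃ h : Monomial m, ∃ p ∈ shears h, h.card = s.card ∧
      ∀ x, ∏ i ∈ s, Y i x = mono h (shearMap p x) := by
  classical
  induction s using Finset.induction_on with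
  | empty =>
    refine ⟨∅, 0, mem_shears.2 ⟨by simp, fun _ _ => rfl⟩, rfl, fun x => ?_⟩
    simp [mono]
  | insert i₀ s hi₀ ih =>
    obtain ⟨h, p, hp, hcard, hprod⟩ := ih
    -- The new form in the coordinates in which the old flat is `x_l = 1`, `l ∈ h`, with the pivot
    -- variables eliminated.
    set y : Word m := fun x => Y i₀ (shearMap p (fillOne h x)) with hy
    have hyaff : IsAffineWord y :=
      ((hY.1 i₀).comp (isAffineWord_shearMap hp)).comp (isAffineWord_fillOne h)
    have hydep : DependsOn y ((Finset.univ.filter (· ∉ h) : Finset (Fin m)) : Set (Fin m)) := by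
      intro u v huv
      have : fillOne h u = fillOne h v := by
        funext i
        by_cases hi : i ∈ h
        · rw [fillOne_of_mem _ hi, fillOne_of_mem _ hi]
        · rw [fillOne_of_notMem _ hi, fillOne_of_notMem _ hi, huv i (by simp [hi])]
      simp only [hy, this]
    have hyon : ∀ x, mono h (shearMap p x) = 1 → y (shearMap p x) = Y i₀ x := by
      intro x hx
      simp only [hy]
      rw [fillOne_eq_self hx, shearMap_shearMap hp]
    have hval : ∀ v, ∃ x, y x = v := by
      intro v
      obtain ⟨x, hx⟩ := hY.2 fun i => if i = i₀ then v else 1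
      have hx' : ∀ i, Y i x = if i = i₀ then v else 1 := fun i => congrFun hx i
      refine ⟨shearMap p x, ?_⟩
      rw [hyon, hx', if_pos rfl]
      rw [← hprod]
      refine Finset.prod_eq_one fun i hi => ?_
      rw [hx', if_neg]
      rintro rfl
      exact hi₀ hi
    obtain ⟨a, ha, z, hz, hyz⟩ := exists_lead (hyaff.mem_of_dependsOn hydep) (by
      obtain ⟨x, hx⟩ := hval (y 0 + 1)
      exact ⟨x, by rw [hx]; simp⟩)
    have hah : a ∉ h := by simpa using ha
    have hzdep := dependsOn_of_mem_affine hz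
    have hzaff := isAffineWord_of_mem hz
    -- The new pivot is the leading variable `x_a`; the other equations lose `x_a` by substituting
    -- `x_a = 1 + z`.
    set p' : Fin m → Word m := fun l => if l = a then z else
      if l ∈ h then (fun x => p l (Function.update x a (1 + z x))) else 0 with hp'
    have hp'mem : p' ∈ shears (insert a h) := by
      refine mem_shears.2 ⟨fun l hl => ?_, fun l hl => ?_⟩
      · by_cases hla : l = a
        · subst hla
          simp only [hp', if_true]
          refine code_mono (affineMonomials_mono fun j hj => ?_) hz
          simp only [Finset.mem_filter, Finset.mem_univ, true_and] at hj
          simp [mem_freeBelow, hj.1, hj.2, hj.2.ne]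
        · have hlh : l ∈ h := by simpa [hla] using hl
          simp only [hp', if_neg hla, if_pos hlh]
          refine IsAffineWord.mem_of_dependsOn ?_ fun u v huv => ?_
          · refine (isAffineWord_shear hp l).comp fun i => ?_
            by_cases hia : i = a
            · subst hia
              simpa only [Function.update_self] using! (isAffineWord_const 1).add hzaff
            · simpa only [Function.update_of_ne hia] using isAffineWord_coord i
          · refine shear_dependsOn hp l fun j hj => ?_
            obtain ⟨hjl, hjh⟩ := mem_freeBelow.1 (Finset.mem_coe.1 hj)
            by_cases hja : j = a
            · subst hja
              rw [Function.update_self, Function.update_self]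
              congr 1
              refine hzdep fun i hi => huv i ?_
              simp only [Finset.coe_filter, Finset.mem_filter, Finset.mem_univ, true_and,
                Set.mem_ofPred_eq] at hi
              simp [mem_freeBelow, hi.1, hi.2.ne, hi.2.trans hjl]
            · rw [Function.update_of_ne hja, Function.update_of_ne hja]
              exact huv j (by simp [mem_freeBelow, hjl, hjh, hja])
      · rw [Finset.mem_insert, not_or] at hl
        simp only [hp', if_neg hl.1, if_neg hl.2]
    refine ⟨insert a h, p', hp'mem, ?_, fun x => ?_⟩
    · rw [Finset.card_insert_of_notMem hah, Finset.card_insert_of_notMem hi₀, hcard]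
    · have e1 : Y i₀ x * mono h (shearMap p x) = (x a + z x) * mono h (shearMap p x) := by
        rcases zmod2_cases (mono h (shearMap p x)) with h0 | h1
        · rw [h0, mul_zero, mul_zero]
        · rw [h1, mul_one, mul_one, ← hyon x h1]
          have : y (shearMap p x) = y x :=
            hydep fun j hj => shearMap_of_notMem hp x (by simpa using hj)
          rw [this, hyz]
          rfl
      have e2 : mono (insert a h) (shearMap p' x) =
          (x a + z x) * mono h (shearMap p' x) := by
        simp only [mono]
        rw [Finset.prod_insert hah]
        simp [shearMap, hp']
      rw [Finset.prod_insert hi₀, hprod, e1, e2]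
      rcases zmod2_cases (x a + z x) with h0 | h1
      · rw [h0, zero_mul, zero_mul]
      · congr 1
        refine Finset.prod_congr rfl fun l hl => ?_
        have hla : l ≠ a := fun e => hah (e ▸ hl)
        have hxa : 1 + z x = x a := by
          rw [← h1, add_assoc, CharTwo.add_self_eq_zero, add_zero]
        simp only [shearMap, hp', if_neg hla, if_pos hl, hxa, Function.update_eq_self]

/-! ### The sign sum of a word -/

/-- The sign `(-1) ^ a`. -/
def sgn (a : ZMod 2) : ℤ := if a = 0 then 1 else -1

/-- The sum `∑ (-1) ^ c(x)` over all points. -/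
def signSum {m : ℕ} (c : Word m) : ℤ := ∑ x, sgn (c x)

lemma signSum_eq {m : ℕ} (c : Word m) : signSum c = 2 ^ m - 2 * (hammingNorm c : ℤ) := by
  have h1 : ∀ x, sgn (c x) = 1 - 2 * (if c x ≠ 0 then 1 else 0 : ℤ) := by
    intro x
    unfold sgn
    by_cases h : c x = 0 <;> simp [h]
  rw [signSum, Finset.sum_congr rfl fun x _ => h1 x, Finset.sum_sub_distrib, ← Finset.mul_sum,
    Finset.sum_boole, hammingNorm]
  simp

lemma two_mul_sum_eq {m : ℕ} (b : Fin m) (f : (Fin m → ZMod 2) → ℤ) :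
    2 * ∑ x, f x = ∑ x, (f (Function.update x b 1) + f (Function.update x b 0)) := by
  have hinv : Function.Involutive fun x : Fin m → ZMod 2 => Function.update x b (x b + 1) := by
    intro x
    simp only [Function.update_self, Function.update_idem]
    rw [add_assoc, CharTwo.add_self_eq_zero, add_zero, Function.update_eq_self]
  have h1 : ∑ x, f x = ∑ x, f (Function.update x b (x b + 1)) :=
    (Equiv.sum_comp hinv.toPerm f).symm
  have h2 : 2 * ∑ x, f x = ∑ x, (f x + f (Function.update x b (x b + 1))) := by
    rw [Finset.sum_add_distrib, ← h1, two_mul]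
  rw [h2]
  refine Finset.sum_congr rfl fun x _ => ?_
  have hx := Function.update_eq_self b x
  rcases zmod2_cases (x b) with h | h <;> rw [h] at hx ⊢
  · rw [hx, zero_add, add_comm]
  · rw [hx, CharTwo.add_self_eq_zero]

lemma signSum_eq_zero_of_slope {m : ℕ} {b : Fin m} {c : Word m} (h : slope b c = 1) :
    signSum c = 0 := by
  have h1 := two_mul_sum_eq b fun x => sgn (c x)
  have h2 : ∀ p q : ZMod 2, p + q = 1 → sgn p + sgn q = 0 := by decide
  rw [Finset.sum_eq_zero fun x _ => h2 _ _ (congrFun h x)] at h1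
  rw [signSum]
  omega

/-- Splitting off a hyperbolic plane `(x_a + z) (x_b + w)` halves the sign sum. -/
lemma signSum_split {m : ℕ} {a b : Fin m} (hab : a ≠ b) {s : Set (Fin m)} (ha : a ∉ s)
    (hb : b ∉ s) {z w q : Word m} (hz : DependsOn z s) (hw : DependsOn w s)
    (hq : DependsOn q s) :
    2 * signSum (((fun x => x a) + z) * ((fun x => x b) + w) + q) = signSum q := by
  have h1 := two_mul_sum_eq b fun x =>
    sgn ((((fun x => x a) + z) * ((fun x => x b) + w) + q : Word m) x)
  have h2 := two_mul_sum_eq a fun x => if x a + z x = 0 then 2 * sgn (q x) else 0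
  have e1 : ∀ L l r : ZMod 2, sgn (L * (1 + l) + r) + sgn (L * (0 + l) + r) =
      if L = 0 then 2 * sgn r else 0 := by decide
  have e2 : ∀ l r : ZMod 2, ((if 1 + l = 0 then 2 * sgn r else 0) +
      if 0 + l = 0 then 2 * sgn r else 0) = 2 * sgn r := by decide
  simp only [Pi.add_apply, Pi.mul_apply, update_eq_of_dependsOn hz hb,
    update_eq_of_dependsOn hw hb, update_eq_of_dependsOn hq hb, Function.update_self,
    Function.update_of_ne hab, e1] at h1
  simp only [update_eq_of_dependsOn hz ha, update_eq_of_dependsOn hq ha,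
    Function.update_self, e2, ← Finset.mul_sum] at h2
  rw [← h1] at h2
  simp only [signSum, Pi.add_apply, Pi.mul_apply]
  linarith

lemma eq_zero_of_signSum {m : ℕ} {c : Word m} (h : signSum c = 2 ^ m) : c = 0 := by
  rw [signSum_eq] at h
  have : hammingNorm c = 0 := by omega
  exact hammingNorm_eq_zero.1 this

lemma signSum_zero {m : ℕ} : signSum (0 : Word m) = 2 ^ m := by
  rw [signSum_eq, hammingNorm_zero]
  simp

/-! ### Splitting a quadratic word -/

/-- A set of monomials of degree at most two in the variables of `S` that is decreasing among
the monomials in these variables. -/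
structure IsQuadraticFamily {m : ℕ} (S : Finset (Fin m)) (J : Finset (Monomial m)) : Prop where
  subset : ∀ t ∈ J, t ⊆ S
  card_le : ∀ t ∈ J, t.card ≤ 2
  closed : ∀ t ∈ J, ∀ t' ⊆ S, Dominated t' t → t' ∈ J

lemma IsQuadraticFamily.filter {m : ℕ} {S : Finset (Fin m)} {J : Finset (Monomial m)}
    (hJ : IsQuadraticFamily S J) {b : Fin m} :
    IsQuadraticFamily (S.erase b) (J.filter (b ∉ ·)) where
  subset t ht i hi := by
    rw [Finset.mem_filter] at ht
    rw [Finset.mem_erase]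
    exact ⟨fun e => ht.2 (e ▸ hi), hJ.subset t ht.1 hi⟩
  card_le t ht := hJ.card_le t (Finset.mem_filter.1 ht).1
  closed t ht t' ht' hd := by
    rw [Finset.mem_filter] at ht ⊢
    refine ⟨hJ.closed t ht.1 t' (ht'.trans (Finset.erase_subset _ _)) hd, fun hb => ?_⟩
    exact Finset.notMem_erase b S (ht' hb)

lemma dominated_pair {m : ℕ} {a b : Fin m} (hab : a ≠ b) {f g : Monomial m} (hf : f.card ≤ 1)
    (hfa : ∀ i ∈ f, i ≤ a) (hg : g.card ≤ 1) (hgb : ∀ i ∈ g, i ≤ b) :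
    Dominated (f ∪ g) {a, b} := by
  have h1 : Dominated f {a} ∧ Dominated g {b} := by
    have H : ∀ (e : Monomial m) (k : Fin m), e.card ≤ 1 → (∀ i ∈ e, i ≤ k) → Dominated e {k} := by
      intro e k he hek
      rcases e.eq_empty_or_nonempty with rfl | ⟨j, hj⟩
      · exact .of_subset (Finset.empty_subset _)
      · have : e = insert j ∅ := by
          ext i
          simp only [insert_empty_eq, Finset.mem_singleton]
          exact ⟨fun hi => Finset.card_le_one.1 he i hi j hj, fun hi => hi ▸ hj⟩
        rw [this, ← insert_empty_eq k]
        exact Dominated.insert (.of_subset subset_rfl) (hek j hj) (by simp)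
    exact ⟨H f a hf hfa, H g b hg hgb⟩
  intro i
  have h2 : (({a, b} : Monomial m).filter (i ≤ ·)).card =
      (({a} : Monomial m).filter (i ≤ ·)).card + (({b} : Monomial m).filter (i ≤ ·)).card := by
    rw [Finset.insert_eq, Finset.filter_union,
      Finset.card_union_of_disjoint (Finset.disjoint_filter_filter (by simpa using hab))]
  rw [h2, Finset.filter_union]
  exact (Finset.card_union_le _ _).trans (Nat.add_le_add (h1.1 i) (h1.2 i))

lemma mul_affine_mem_code {m : ℕ} {S : Finset (Fin m)} {J : Finset (Monomial m)}
    (hJ : IsQuadraticFamily S J) {a b : Fin m} (hab : a < b) (hmem : {a, b} ∈ J)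
    {T U : Finset (Fin m)} (hT : T ⊆ S) (hTa : ∀ i ∈ T, i ≤ a) (hU : U ⊆ S)
    (hUb : ∀ i ∈ U, i ≤ b) {J' : Finset (Monomial m)}
    (hJ' : ∀ t ∈ J, t ⊆ T ∪ U → t ∈ J') {z w : Word m}
    (hz : z ∈ code (affineMonomials T)) (hw : w ∈ code (affineMonomials U)) :
    z * w ∈ code J' := by
  refine mul_mem_code (fun f hf g hg => ?_) hz hw
  rw [mem_affineMonomials] at hf hg
  refine hJ' _ (hJ.closed _ hmem _ (Finset.union_subset (hf.1.trans hT) (hg.1.trans hU)) ?_)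
    (Finset.union_subset_union hf.1 hg.1)
  exact dominated_pair hab.ne hf.2 (fun i hi => hTa i (hf.1 hi)) hg.2
    fun i hi => hUb i (hg.1 hi)

/-- A quadratic word in which the last variable `x_b` occurs and whose sign sum does not vanish is
`(x_a + z) (x_b + w) + q'`, where `x_a` is the leading variable of the coefficient of `x_b` and
`q'` does not involve `x_a`, `x_b`. -/
lemma exists_split {m : ℕ} {S : Finset (Fin m)} {J : Finset (Monomial m)}
    (hJ : IsQuadraticFamily S J) {b : Fin m} (hbmax : ∀ i ∈ S, i ≤ b)
    {q : Word m} (hq : q ∈ code J) (hne : slope b q ≠ 0) (hW : signSum q ≠ 0) :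
    ∃ a ∈ S.erase b, {a, b} ∈ J ∧ ∃ z ∈ code (affineMonomials (S.filter (· < a))),
      ∃ w ∈ code (affineMonomials ((S.erase b).erase a)),
      ∃ q' ∈ code ((J.filter (b ∉ ·)).filter (a ∉ ·)),
        q = ((fun x => x a) + z) * ((fun x => x b) + w) + q' := by
  have hlink : ∀ (S' : Finset (Fin m)) (J' : Finset (Monomial m)) (c : Fin m),
      IsQuadraticFamily S' J' → link J' {c} ⊆ affineMonomials (S'.erase c) := by
    intro S' J' c hJ' t ht
    obtain ⟨h1, h2⟩ := mem_link.1 ht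
    rw [Finset.disjoint_singleton_left] at h1
    rw [← Finset.insert_eq] at h2
    have h3 := hJ'.card_le _ h2
    rw [Finset.card_insert_of_notMem h1] at h3
    refine mem_affineMonomials.2 ⟨fun i hi => Finset.mem_erase.2 ⟨fun e => h1 (e ▸ hi), ?_⟩,
      by omega⟩
    exact hJ'.subset _ h2 (Finset.mem_insert_of_mem hi)
  have hl := slope_mem_code hq b
  obtain ⟨a, ha, z, hz, hlz⟩ := exists_lead (code_mono (hlink S J b hJ) hl) (by
    by_contra hc
    push Not at hc
    rcases zmod2_cases (slope b q 0) with h0 | h1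
    · exact hne (funext fun x => (hc x).trans h0)
    · exact hW (signSum_eq_zero_of_slope (funext fun x => (hc x).trans h1)))
  obtain ⟨hab, haS⟩ := Finset.mem_erase.1 ha
  have hablt : a < b := lt_of_le_of_ne (hbmax a haS) hab
  have hsub : (S.erase b).filter (· < a) ⊆ S.filter (· < a) :=
    Finset.filter_subset_filter _ (Finset.erase_subset _ _)
  have hz' := code_mono (affineMonomials_mono hsub) hz
  have habJ : {a, b} ∈ J := by
    have h1 := slope_mem_code hl a
    have h2 : slope a (slope b q) ≠ 0 := by
      rw [hlz, map_add, slope_eq_zero_of_dependsOn (dependsOn_of_mem_affine hz) (by simp),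
        add_zero, ← mono_singleton, slope_mono_of_mem (by simp)]
      intro h
      have := congrFun h 0
      simp [mono] at this
    obtain ⟨t, ht⟩ := nonempty_of_mem_code h1 h2
    rw [link_link J (by simpa using hab.symm), mem_link] at ht
    refine hJ.closed _ ht.2 _ ?_ (.of_subset ?_)
    · intro i hi
      rcases Finset.mem_insert.1 hi with rfl | hi
      · exact haS
      · rw [Finset.mem_singleton] at hi
        subst hi
        exact hJ.subset _ ht.2 (by simp)
    · intro i hi
      rw [Finset.mem_union, Finset.mem_insert, Finset.mem_singleton]
      rcases Finset.mem_insert.1 hi with rfl | hi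
      · exact Or.inl (Or.inr rfl)
      · exact Or.inl (Or.inl (Finset.mem_singleton.1 hi))
  have hq0 := restrictZero_mem_code hq b
  have hw := code_mono (hlink _ _ a hJ.filter) (slope_mem_code hq0 a)
  have hr := restrictZero_mem_code hq0 a
  have hzw : z * slope a (restrictZero b q) ∈ code ((J.filter (b ∉ ·)).filter (a ∉ ·)) := by
    refine mul_affine_mem_code hJ hablt habJ (Finset.filter_subset _ _) ?_
      ((Finset.erase_subset _ _).trans (Finset.erase_subset _ _)) ?_ ?_ hz' hw
    · intro i hi
      exact (Finset.mem_filter.1 hi).2.le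
    · intro i hi
      exact hbmax i (Finset.mem_of_mem_erase (Finset.mem_of_mem_erase hi))
    · intro t ht htT
      simp only [Finset.mem_filter]
      refine ⟨⟨ht, fun h => ?_⟩, fun h => ?_⟩
      · have h1 := htT h
        simp only [Finset.mem_union, Finset.mem_filter, Finset.mem_erase, ne_eq,
          not_true_eq_false, false_and, and_false, or_false] at h1
        exact hablt.not_gt h1.2
      · simpa using htT h
  refine ⟨a, ha, habJ, z, hz', _, hw, _, Submodule.add_mem _ hzw hr, ?_⟩
  have h1 : q = (fun x => x b) * ((fun x => x a) + z) +
      ((fun x => x a) * slope a (restrictZero b q) + restrictZero a (restrictZero b q)) := by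
    rw [← hlz, ← eq_slope_add a, ← eq_slope_add b]
  have h0 : z * slope a (restrictZero b q) + z * slope a (restrictZero b q) = 0 := pi_add_self _
  refine h1.trans ?_
  -- The two sides differ by `2 z w = 0`.
  linear_combination -h0

lemma split_mem_code {m : ℕ} {S : Finset (Fin m)} {J : Finset (Monomial m)}
    (hJ : IsQuadraticFamily S J) {b : Fin m} (hb : b ∈ S) (hbmax : ∀ i ∈ S, i ≤ b) {a : Fin m}
    (ha : a ∈ S.erase b) (habJ : {a, b} ∈ J) {z w q' : Word m}
    (hz : z ∈ code (affineMonomials (S.filter (· < a))))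
    (hw : w ∈ code (affineMonomials ((S.erase b).erase a)))
    (hq' : q' ∈ code ((J.filter (b ∉ ·)).filter (a ∉ ·))) :
    ((fun x => x a) + z) * ((fun x => x b) + w) + q' ∈ code J := by
  obtain ⟨hab, haS⟩ := Finset.mem_erase.1 ha
  refine add_mem ?_
    (code_mono ((Finset.filter_subset _ _).trans (Finset.filter_subset _ _)) hq')
  refine mul_affine_mem_code hJ (lt_of_le_of_ne (hbmax a haS) hab) habJ
    (T := S.filter (· ≤ a)) (U := S) (Finset.filter_subset _ _)
    (fun i hi => (Finset.mem_filter.1 hi).2) subset_rfl hbmax (fun t ht _ => ht)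
    (add_mem (coord_mem_affine (by simp [haS])) ?_) (add_mem (coord_mem_affine hb) ?_)
  · refine code_mono (affineMonomials_mono fun i hi => ?_) hz
    rw [Finset.mem_filter] at hi ⊢
    exact ⟨hi.1, hi.2.le⟩
  · exact code_mono (affineMonomials_mono
      ((Finset.erase_subset _ _).trans (Finset.erase_subset _ _))) hw

lemma slope_coord_self {m : ℕ} (b : Fin m) : slope b (fun x => x b) = 1 := by
  rw [← mono_singleton, slope_mono_of_mem (by simp)]
  simp [mono_empty]

lemma slope_split {m : ℕ} {a b : Fin m} (hab : a ≠ b) {s : Set (Fin m)}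
    (hb : b ∉ s) {z w q : Word m} (hz : DependsOn z s) (hw : DependsOn w s)
    (hq : DependsOn q s) :
    slope b (((fun x => x a) + z) * ((fun x => x b) + w) + q) = (fun x => x a) + z := by
  funext x
  simp only [slope_apply, Pi.add_apply, Pi.mul_apply, update_eq_of_dependsOn hz hb,
    update_eq_of_dependsOn hw hb, update_eq_of_dependsOn hq hb, Function.update_self,
    Function.update_of_ne hab]
  have e : ∀ L l r : ZMod 2, L * (1 + l) + r + (L * (0 + l) + r) = L := by decide
  exact e _ _ _

lemma slope_restrictZero_split {m : ℕ} {a b : Fin m} (hab : a ≠ b) {s : Set (Fin m)}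
    (ha : a ∉ s) (hb : b ∉ s) {z w q : Word m} (hz : DependsOn z s) (hw : DependsOn w s)
    (hq : DependsOn q s) :
    slope a (restrictZero b (((fun x => x a) + z) * ((fun x => x b) + w) + q)) = w := by
  funext x
  simp only [slope_apply, restrictZero_apply, Pi.add_apply, Pi.mul_apply,
    update_eq_of_dependsOn hz hb, update_eq_of_dependsOn hw hb, update_eq_of_dependsOn hq hb,
    update_eq_of_dependsOn hz ha, update_eq_of_dependsOn hw ha, update_eq_of_dependsOn hq ha,
    Function.update_self, Function.update_of_ne hab]
  have e : ∀ z l r : ZMod 2, (1 + z) * (0 + l) + r + ((0 + z) * (0 + l) + r) = l := by decide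
  exact e _ _ _

/-! ### Hyperbolic quadratic words -/

open Classical in
/-- The words of `code J` with sign sum `2 ^ (m - μ)`. For a quadratic family `J` these are the
quadratic words affinely equivalent to `x_1 x_2 + ⋯ + x_{2μ-1} x_{2μ}`. -/
noncomputable def hyperbolicWords {m : ℕ} (J : Finset (Monomial m)) (μ : ℕ) : Finset (Word m) :=
  Finset.univ.filter fun q => q ∈ code J ∧ signSum q * 2 ^ μ = 2 ^ m

lemma mem_hyperbolicWords {m : ℕ} {J : Finset (Monomial m)} {μ : ℕ} {q : Word m} :
    q ∈ hyperbolicWords J μ ↔ q ∈ code J ∧ signSum q * 2 ^ μ = 2 ^ m := by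
  simp [hyperbolicWords]

lemma signSum_ne_zero {m μ : ℕ} {q : Word m} (h : signSum q * 2 ^ μ = 2 ^ m) :
    signSum q ≠ 0 := by
  intro h0
  rw [h0, zero_mul] at h
  exact (pow_pos (by norm_num : (0 : ℤ) < 2) m).ne h

lemma hyperbolicWords_zero {m : ℕ} (J : Finset (Monomial m)) : hyperbolicWords J 0 = {0} := by
  ext q
  rw [mem_hyperbolicWords, Finset.mem_singleton, pow_zero, mul_one]
  constructor
  · exact fun h => eq_zero_of_signSum h.2
  · rintro rfl
    exact ⟨zero_mem _, signSum_zero⟩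

lemma hyperbolicWords_of_isEmpty {m : ℕ} {J : Finset (Monomial m)} (hJ : IsQuadraticFamily ∅ J)
    (μ : ℕ) : hyperbolicWords J (μ + 1) = ∅ := by
  refine Finset.eq_empty_of_forall_notMem fun q hq => ?_
  obtain ⟨hq, hs⟩ := mem_hyperbolicWords.1 hq
  have hdep := dependsOn_of_mem_code hJ.subset hq
  have hc : ∀ x, q x = q 0 := fun x => hdep (by simp)
  have h1 : signSum q = 2 ^ m * sgn (q 0) := by
    simp [signSum, hc]
  have hpos : (0 : ℤ) < 2 ^ m := by positivity
  have h2 : sgn (q 0) * 2 ^ (μ + 1) = 1 := by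
    rw [h1] at hs
    refine mul_left_cancel₀ hpos.ne' ?_
    rw [← mul_assoc, hs, mul_one]
  have h3 : (2 : ℤ) ∣ 1 := ⟨sgn (q 0) * 2 ^ μ, by rw [← h2]; ring⟩
  norm_num at h3

lemma mem_code_filter_of_slope {m : ℕ} {J : Finset (Monomial m)} {q : Word m} (hq : q ∈ code J)
    {b : Fin m} (h : slope b q = 0) : q ∈ code (J.filter (b ∉ ·)) := by
  have h1 := restrictZero_mem_code hq b
  have h2 := eq_slope_add b q
  rw [h, mul_zero, zero_add] at h2
  rwa [← h2] at h1

lemma dependsOn_of_mem_filter {m : ℕ} {S : Finset (Fin m)} {J : Finset (Monomial m)}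
    (hJ : IsQuadraticFamily S J) {a b : Fin m} {q : Word m}
    (hq : q ∈ code ((J.filter (b ∉ ·)).filter (a ∉ ·))) :
    DependsOn q (((S.erase b).erase a : Finset (Fin m)) : Set (Fin m)) :=
  dependsOn_of_mem_code (hJ.filter.filter).subset hq

lemma dependsOn_mono {m : ℕ} {c : Word m} {s t : Set (Fin m)} (h : s ⊆ t) (hc : DependsOn c s) :
    DependsOn c t := fun _ _ hxy => hc fun i hi => hxy i (h hi)

lemma dependsOn_lower {m : ℕ} {S : Finset (Fin m)} {a b : Fin m} (hab : a < b) {z : Word m}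
    (hz : z ∈ code (affineMonomials (S.filter (· < a)))) :
    DependsOn z (((S.erase b).erase a : Finset (Fin m)) : Set (Fin m)) := by
  refine dependsOn_mono ?_ (dependsOn_of_mem_affine hz)
  intro i hi
  simp only [Finset.coe_filter, Set.mem_ofPred_eq] at hi
  simp [hi.1, hi.2.ne, (hi.2.trans hab).ne]

/-- Every word of `hyperbolicWords J μ` is `∑ Y_{j,0} Y_{j,1}` for `2μ` jointly surjective affine
words in the variables of `S`. -/
lemma exists_hyperbolic_form {m : ℕ} {S : Finset (Fin m)} : ∀ {J : Finset (Monomial m)},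
    IsQuadraticFamily S J → ∀ {μ : ℕ} {q : Word m}, q ∈ hyperbolicWords J μ →
    ∃ Y : Fin μ × Fin 2 → Word m, (∀ i, IsAffineWord (Y i)) ∧
      (∀ i, DependsOn (Y i) (S : Set (Fin m))) ∧
      (∀ (v : Fin μ × Fin 2 → ZMod 2) (x : Fin m → ZMod 2),
        ∃ x', (∀ j, j ∉ S → x' j = x j) ∧ ∀ i, Y i x' = v i) ∧
      q = ∑ j, Y (j, 0) * Y (j, 1) := by
  induction S using Finset.strongInduction with
  | H S ih =>
    intro J hJ μ q hq
    cases μ with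
    | zero =>
      rw [hyperbolicWords_zero, Finset.mem_singleton] at hq
      exact ⟨fun _ => 0, fun i => i.1.elim0, fun i => i.1.elim0,
        fun v x => ⟨x, fun _ _ => rfl, fun i => i.1.elim0⟩, by simp [hq]⟩
    | succ μ =>
      rcases S.eq_empty_or_nonempty with rfl | hS
      · rw [hyperbolicWords_of_isEmpty hJ] at hq
        exact absurd hq (Finset.notMem_empty _)
      set b := S.max' hS with hb
      have hbS : b ∈ S := S.max'_mem hS
      have hbmax : ∀ i ∈ S, i ≤ b := fun i hi => S.le_max' i hi
      obtain ⟨hqJ, hs⟩ := mem_hyperbolicWords.1 hq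
      by_cases hsl : slope b q = 0
      · obtain ⟨Y, h1, h2, h3, h4⟩ := ih (S.erase b) (Finset.erase_ssubset hbS) hJ.filter
          (mem_hyperbolicWords.2 ⟨mem_code_filter_of_slope hqJ hsl, hs⟩)
        refine ⟨Y, h1, fun i => dependsOn_mono (by simp) (h2 i), fun v x => ?_, h4⟩
        obtain ⟨x', hx1, hx2⟩ := h3 v x
        exact ⟨x', fun j hj => hx1 j fun h => hj (Finset.mem_of_mem_erase h), hx2⟩
      · obtain ⟨a, ha, habJ, z, hz, w, hw, q', hq', rfl⟩ :=
          exists_split hJ hbmax hqJ hsl (signSum_ne_zero hs)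
        obtain ⟨hab, haS⟩ := Finset.mem_erase.1 ha
        have hablt : a < b := lt_of_le_of_ne (hbmax a haS) hab
        have dz := dependsOn_lower hablt hz
        have dw := dependsOn_of_mem_affine hw
        have dq := dependsOn_of_mem_filter hJ hq'
        have hsum := signSum_split hab (by simp) (by simp) dz dw dq
        obtain ⟨Y, h1, h2, h3, h4⟩ := ih ((S.erase b).erase a)
          ((Finset.erase_ssubset ha).trans (Finset.erase_ssubset hbS)) hJ.filter.filter
          (μ := μ) (mem_hyperbolicWords.2 ⟨hq', by rw [← hsum, ← hs, pow_succ]; ring⟩)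
        have hsub : (((S.erase b).erase a : Finset (Fin m)) : Set (Fin m)) ⊆ (S : Set (Fin m)) :=
          fun i hi => Finset.mem_of_mem_erase (Finset.mem_of_mem_erase (Finset.mem_coe.1 hi))
        set P : Fin 2 → Word m := ![(fun x => x a) + z, (fun x => x b) + w] with hP
        have P0 : P 0 = (fun x => x a) + z := rfl
        have P1 : P 1 = (fun x => x b) + w := rfl
        refine ⟨fun i => Fin.cases (P i.2) (fun j => Y (j, i.2)) i.1, ?_, ?_, ?_, ?_⟩
        · rintro ⟨i, k⟩
          induction i using Fin.cases with
          | zero =>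
            simp only [Fin.cases_zero]
            fin_cases k
            · exact (isAffineWord_coord a).add (isAffineWord_of_mem hz)
            · exact (isAffineWord_coord b).add (isAffineWord_of_mem hw)
          | succ j => exact h1 (j, k)
        · rintro ⟨i, k⟩
          induction i using Fin.cases with
          | zero =>
            simp only [Fin.cases_zero]
            fin_cases k
            · intro x y hxy
              exact congrArg₂ (· + ·) (hxy a (Finset.mem_coe.2 haS))
                (dependsOn_mono hsub dz hxy)
            · intro x y hxy
              exact congrArg₂ (· + ·) (hxy b (Finset.mem_coe.2 hbS))
                (dependsOn_mono hsub dw hxy)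
          | succ j => exact dependsOn_mono hsub (h2 (j, k))
        · intro v x
          obtain ⟨x₁, hx1, hx2⟩ := h3 (fun i => v (i.1.succ, i.2)) x
          -- The values at `x_a` and `x_b` are free once the other coordinates are fixed.
          set x₂ := Function.update (Function.update x₁ a (v (0, 0) + z x₁)) b (v (0, 1) + w x₁)
            with hx₂
          have hupd : ∀ {c : Word m},
              DependsOn c (((S.erase b).erase a : Finset (Fin m)) : Set (Fin m)) →
              c x₂ = c x₁ := by
            intro c hc
            rw [hx₂, update_eq_of_dependsOn hc (by simp), update_eq_of_dependsOn hc (by simp)]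
          refine ⟨x₂, fun j hj => ?_, ?_⟩
          · have hja : j ≠ a := fun e => hj (e ▸ haS)
            have hjb : j ≠ b := fun e => hj (e ▸ hbS)
            rw [hx₂, Function.update_of_ne hjb, Function.update_of_ne hja]
            exact hx1 j fun h => hj (hsub (Finset.mem_coe.2 h))
          · rintro ⟨i, k⟩
            induction i using Fin.cases with
            | zero =>
              simp only [Fin.cases_zero]
              fin_cases k
              · change x₂ a + z x₂ = v (0, 0)
                rw [hupd dz, hx₂, Function.update_of_ne hab, Function.update_self, add_assoc,
                  CharTwo.add_self_eq_zero, add_zero]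
              · change x₂ b + w x₂ = v (0, 1)
                rw [hupd dw, hx₂, Function.update_self, add_assoc,
                  CharTwo.add_self_eq_zero, add_zero]
            | succ j =>
              change Y (j, k) x₂ = _
              rw [hupd (h2 (j, k)), hx2]
        · rw [Fin.sum_univ_succ]
          simp only [Fin.cases_zero, Fin.cases_succ]
          rw [← h4, P0, P1]

/-! ### Counting hyperbolic words -/

/-- The recursion on the last variable `x_b`: either it does not occur, or a hyperbolic plane
`(x_a + z) (x_b + w)` splits off, and `a`, `z`, `w` and the rest are determined by the word. -/
lemma card_hyperbolicWords_succ {m : ℕ} {S : Finset (Fin m)} {J : Finset (Monomial m)}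
    (hJ : IsQuadraticFamily S J) {b : Fin m} (hb : b ∈ S) (hbmax : ∀ i ∈ S, i ≤ b) (μ : ℕ) :
    (hyperbolicWords J (μ + 1)).card = (hyperbolicWords (J.filter (b ∉ ·)) (μ + 1)).card +
      ∑ a ∈ (S.erase b).filter (fun a => {a, b} ∈ J),
        2 ^ ((S.filter (· < a)).card + 1) * 2 ^ (((S.erase b).erase a).card + 1) *
          (hyperbolicWords ((J.filter (b ∉ ·)).filter (a ∉ ·)) μ).card := by
  classical
  set G : Fin m → Word m × Word m × Word m → Word m := fun a d =>
    ((fun x => x a) + d.1) * ((fun x => x b) + d.2.1) + d.2.2 with hG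
  set D : Fin m → Finset (Word m × Word m × Word m) := fun a =>
    codeFinset (affineMonomials (S.filter (· < a))) ×ˢ
      codeFinset (affineMonomials ((S.erase b).erase a)) ×ˢ
      hyperbolicWords ((J.filter (b ∉ ·)).filter (a ∉ ·)) μ with hD
  set A := (S.erase b).filter (fun a => {a, b} ∈ J) with hA
  have hDmem : ∀ a ∈ A, ∀ d ∈ D a, a ≠ b ∧ d.1 ∈ code (affineMonomials (S.filter (· < a))) ∧
      d.2.1 ∈ code (affineMonomials ((S.erase b).erase a)) ∧
      d.2.2 ∈ code ((J.filter (b ∉ ·)).filter (a ∉ ·)) ∧ signSum d.2.2 * 2 ^ μ = 2 ^ m ∧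
      DependsOn d.1 (((S.erase b).erase a : Finset (Fin m)) : Set (Fin m)) ∧
      DependsOn d.2.1 (((S.erase b).erase a : Finset (Fin m)) : Set (Fin m)) ∧
      DependsOn d.2.2 (((S.erase b).erase a : Finset (Fin m)) : Set (Fin m)) := by
    intro a ha d hd
    rw [hA, Finset.mem_filter, Finset.mem_erase] at ha
    simp only [hD, Finset.mem_product, mem_codeFinset, mem_hyperbolicWords] at hd
    obtain ⟨h1, h2, h3, h4⟩ := hd
    exact ⟨ha.1.1, h1, h2, h3, h4,
      dependsOn_lower (lt_of_le_of_ne (hbmax a ha.1.2) ha.1.1) h1,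
      dependsOn_of_mem_affine h2, dependsOn_of_mem_filter hJ h3⟩
  have hslope : ∀ a ∈ A, ∀ d ∈ D a, slope b (G a d) = (fun x => x a) + d.1 := by
    intro a ha d hd
    obtain ⟨h1, -, -, -, -, h2, h3, h4⟩ := hDmem a ha d hd
    exact slope_split h1 (by simp) h2 h3 h4
  have hunion : hyperbolicWords J (μ + 1) = hyperbolicWords (J.filter (b ∉ ·)) (μ + 1) ∪
      A.biUnion fun a => (D a).image (G a) := by
    ext q
    rw [Finset.mem_union, Finset.mem_biUnion, mem_hyperbolicWords, mem_hyperbolicWords]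
    constructor
    · rintro ⟨hq, hs⟩
      by_cases hsl : slope b q = 0
      · exact Or.inl ⟨mem_code_filter_of_slope hq hsl, hs⟩
      · obtain ⟨a, ha, habJ, z, hz, w, hw, q', hq', rfl⟩ :=
          exists_split hJ hbmax hq hsl (signSum_ne_zero hs)
        obtain ⟨hab, haS⟩ := Finset.mem_erase.1 ha
        have hsum := signSum_split hab (by simp) (by simp)
          (dependsOn_lower (lt_of_le_of_ne (hbmax a haS) hab) hz)
          (dependsOn_of_mem_affine hw) (dependsOn_of_mem_filter hJ hq')
        refine Or.inr ⟨a, Finset.mem_filter.2 ⟨ha, habJ⟩,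
          Finset.mem_image.2 ⟨(z, w, q'), ?_, rfl⟩⟩
        simp only [hD, Finset.mem_product, mem_codeFinset, mem_hyperbolicWords]
        exact ⟨hz, hw, hq', by rw [← hsum, ← hs, pow_succ]; ring⟩
    · rintro (⟨hq, hs⟩ | ⟨a, ha, hq⟩)
      · exact ⟨code_mono (Finset.filter_subset _ _) hq, hs⟩
      · obtain ⟨d, hd, rfl⟩ := Finset.mem_image.1 hq
        obtain ⟨hab, h1, h2, h3, hs, d1, d2, d3⟩ := hDmem a ha d hd
        have ha' := Finset.mem_filter.1 ha
        refine ⟨split_mem_code hJ hb hbmax ha'.1 ha'.2 h1 h2 h3, ?_⟩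
        rw [← hs, ← signSum_split hab (by simp) (by simp) d1 d2 d3, pow_succ]
        ring
  have hlead : ∀ a ∈ A, ∀ d ∈ D a, slope b (G a d) ≠ 0 ∧ slope a (slope b (G a d)) = 1 ∧
      ∀ a', a < a' → slope a' (slope b (G a d)) = 0 := by
    intro a ha d hd
    have hz := dependsOn_of_mem_affine (hDmem a ha d hd).2.1
    have h1 : slope a (slope b (G a d)) = 1 := by
      rw [hslope a ha d hd, map_add, slope_coord_self, slope_eq_zero_of_dependsOn hz (by simp),
        add_zero]
    refine ⟨fun h0 => ?_, h1, fun a' ha' => ?_⟩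
    · rw [h0, map_zero] at h1
      exact zero_ne_one h1
    · rw [hslope a ha d hd, map_add, slope_eq_zero_of_dependsOn hz (by simp [ha'.le]),
        ← mono_singleton, slope_mono_of_notMem (by simpa using ha'.ne'), add_zero]
  have hdisj1 : Disjoint (hyperbolicWords (J.filter (b ∉ ·)) (μ + 1))
      (A.biUnion fun a => (D a).image (G a)) := by
    rw [Finset.disjoint_left]
    intro q hq hq'
    obtain ⟨a, ha, hq'⟩ := Finset.mem_biUnion.1 hq'
    obtain ⟨d, hd, rfl⟩ := Finset.mem_image.1 hq'
    refine (hlead a ha d hd).1 ?_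
    exact slope_eq_zero_of_dependsOn
      (dependsOn_of_mem_code hJ.filter.subset (mem_hyperbolicWords.1 hq).1) (by simp)
  have hdisj2 : (A : Set (Fin m)).PairwiseDisjoint fun a => (D a).image (G a) := by
    have H : ∀ a ∈ A, ∀ a' ∈ A, a < a' → ∀ d ∈ D a, ∀ d' ∈ D a', G a d ≠ G a' d' := by
      intro a ha a' ha' hlt d hd d' hd' heq
      have h1 := (hlead a ha d hd).2.2 a' hlt
      rw [heq, (hlead a' ha' d' hd').2.1] at h1
      exact one_ne_zero h1
    intro a ha a' ha' hne
    rw [Function.onFun, Finset.disjoint_left]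
    intro q hq hq'
    obtain ⟨d, hd, rfl⟩ := Finset.mem_image.1 hq
    obtain ⟨d', hd', heq⟩ := Finset.mem_image.1 hq'
    rcases lt_or_gt_of_ne hne with h | h
    · exact H a ha a' ha' h d hd d' hd' heq.symm
    · exact H a' ha' a ha h d' hd' d hd heq
  rw [hunion, Finset.card_union_of_disjoint hdisj1, Finset.card_biUnion hdisj2]
  congr 1
  refine Finset.sum_congr rfl fun a ha => ?_
  rw [Finset.card_image_of_injOn]
  · simp only [hD, Finset.card_product, card_codeFinset, card_affineMonomials]
    ring
  · intro d hd d' hd' heq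
    have hd := Finset.mem_coe.1 hd
    have hd' := Finset.mem_coe.1 hd'
    have e1 : d.1 = d'.1 := by
      have := (hslope a ha d hd).symm.trans ((congrArg (slope b) heq).trans (hslope a ha d' hd'))
      exact add_left_cancel this
    have e2 : d.2.1 = d'.2.1 := by
      obtain ⟨h1, -, -, -, -, h2, h3, h4⟩ := hDmem a ha d hd
      obtain ⟨-, -, -, -, -, h2', h3', h4'⟩ := hDmem a ha d' hd'
      rw [← slope_restrictZero_split h1 (by simp) (by simp) h2 h3 h4,
        ← slope_restrictZero_split h1 (by simp) (by simp) h2' h3' h4']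
      exact congrArg (fun q => slope a (restrictZero b q)) heq
    have e3 : d.2.2 = d'.2.2 := by
      simp only [hG, e1, e2] at heq
      exact add_left_cancel heq
    exact Prod.ext e1 (Prod.ext e2 e3)

/-! ### The sum over matchings -/

/-- `∑ #{j ∈ S : j < i, j ∉ t}` over `i ∈ t`, the size of `λ_t` inside the set of variables
`S`. -/
def lambdaIn {m : ℕ} (S : Finset (Fin m)) (t : Monomial m) : ℕ :=
  ∑ i ∈ t, (S.filter fun j => j < i ∧ j ∉ t).card

open Classical in
/-- The sets of `μ` pairwise coprime monomials of degree two in `J`. -/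
noncomputable def matchings {m : ℕ} (J : Finset (Monomial m)) (μ : ℕ) :
    Finset (Finset (Monomial m)) :=
  ((degPart J 2).powersetCard μ).filter fun F => ∀ t ∈ F, ∀ u ∈ F, t ≠ u → Disjoint t u

lemma mem_matchings {m : ℕ} {J : Finset (Monomial m)} {μ : ℕ} {F : Finset (Monomial m)} :
    F ∈ matchings J μ ↔ (∀ t ∈ F, t ∈ J ∧ t.card = 2) ∧ F.card = μ ∧
      ∀ t ∈ F, ∀ u ∈ F, t ≠ u → Disjoint t u := by
  simp only [matchings, degPart, Finset.mem_filter, Finset.mem_powersetCard, Finset.subset_iff,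
    and_assoc]

/-- The contribution of a matching `F` to the number of hyperbolic words in the variables of `S`:
it is the number of words obtained by splitting off hyperbolic planes with leading pairs `F`. -/
noncomputable def matchingWeight {m : ℕ} (S : Finset (Fin m)) (F : Finset (Monomial m)) : ℚ :=
  2 ^ (2 * F.card + ∑ t ∈ F, lambdaIn S t) / 2 ^ alphaSum ∅ F

lemma dominated_pair_left {m : ℕ} {a b : Fin m} {t : Monomial m} (ht : t.card = 2)
    (htb : ∀ i ∈ t, i < b) (hab : a < b) {i : Fin m} (hi : i ∈ t) (hia : i < a) :
    Dominated t {a, b} := by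
  have h1 : t = {i} ∪ t.erase i := by
    rw [← Finset.insert_eq, Finset.insert_erase hi]
  rw [h1]
  refine dominated_pair hab.ne (by simp) (by simpa using hia.le) ?_
    fun j hj => (htb j (Finset.mem_of_mem_erase hj)).le
  rw [Finset.card_erase_of_mem hi, ht]

/-- With `b` above all variables in question, the collision exponent of `x_a x_b` and a coprime
`t` is the number of variables of `t` above `x_a`. -/
lemma alpha_pair {m : ℕ} {a b : Fin m} (hab : a < b) {t : Monomial m} (ht : t.card = 2)
    (htb : ∀ i ∈ t, i < b) (hta : a ∉ t) : alpha {a, b} t = (t.filter (a < ·)).card := by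
  have hnot : ¬ PrecEq {a, b} t := by
    rw [precEq_iff_dominated]
    intro h
    have h1 := h b
    rw [Finset.card_eq_zero.2 (Finset.filter_eq_empty_iff.2 fun i hi => (htb i hi).not_ge)] at h1
    have h2 : b ∈ ({a, b} : Monomial m).filter (b ≤ ·) := by simp
    exact absurd (Finset.card_pos.2 ⟨b, h2⟩) (by omega)
  by_cases hlow : ∃ i ∈ t, i < a
  · obtain ⟨i, hi, hia⟩ := hlow
    have hle : PrecEq t {a, b} :=
      precEq_iff_dominated.2 (dominated_pair_left ht htb hab hi hia)
    have hsplit : t = insert i (t.erase i) := (Finset.insert_erase hi).symm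
    have hc : (t.erase i).card = 1 := by rw [Finset.card_erase_of_mem hi, ht]
    obtain ⟨d, hd⟩ := Finset.card_eq_one.1 hc
    have hdt : d ∈ t := Finset.mem_of_mem_erase (a := i) (by rw [hd]; simp)
    have hda : d ≠ a := fun e => hta (e ▸ hdt)
    rw [hd] at hsplit
    unfold alpha
    rw [if_neg fun h => h.2 hle]
    by_cases hd' : d < a
    · rw [if_pos]
      · rw [hsplit, eq_comm, Finset.card_eq_zero, Finset.filter_eq_empty_iff]
        intro j hj
        rcases Finset.mem_insert.1 hj with rfl | hj
        · exact hia.not_gt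
        · rw [Finset.mem_singleton.1 hj]; exact hd'.not_gt
      · left
        intro k hk j hj
        have hja : j < a := by
          rw [hsplit] at hj
          rcases Finset.mem_insert.1 hj with rfl | hj
          · exact hia
          · rw [Finset.mem_singleton.1 hj]; exact hd'
        rcases Finset.mem_insert.1 hk with rfl | hk
        · exact hja
        · rw [Finset.mem_singleton.1 hk]; exact hja.trans hab
    · have had : a < d := lt_of_le_of_ne (not_lt.1 hd') hda.symm
      rw [if_neg]
      · have : t.filter (a < ·) = {d} := by
          rw [hsplit]
          ext j
          simp only [Finset.mem_filter, Finset.mem_insert, Finset.mem_singleton]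
          constructor
          · rintro ⟨rfl | rfl, h⟩
            · exact absurd h hia.not_gt
            · rfl
          · rintro rfl
            exact ⟨Or.inr rfl, had⟩
        rw [this, Finset.card_singleton]
      · rintro (h | h)
        · exact absurd (h a (by simp) d hdt) hd'
        · exact absurd (h a (by simp) i hi) hia.not_gt
  · push Not at hlow
    have hgt : ∀ i ∈ t, a < i := fun i hi =>
      lt_of_le_of_ne (hlow i hi) fun e => hta (e ▸ hi)
    have hnot' : ¬ PrecEq t {a, b} := by
      rw [precEq_iff_dominated]
      intro h
      have hne : t.Nonempty := by rw [← Finset.card_pos, ht]; norm_num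
      have h1 := h (t.min' hne)
      rw [Finset.filter_true_of_mem fun i hi => t.min'_le i hi, ht] at h1
      have h2 : ({a, b} : Monomial m).filter (t.min' hne ≤ ·) ⊆ {b} := by
        intro j hj
        obtain ⟨hj1, hj2⟩ := Finset.mem_filter.1 hj
        rcases Finset.mem_insert.1 hj1 with rfl | hj1
        · exact absurd hj2 (hgt _ (t.min'_mem hne)).not_ge
        · exact hj1
      have h3 := Finset.card_le_card h2
      rw [Finset.card_singleton] at h3
      omega
    unfold alpha
    rw [if_pos ⟨hnot, hnot'⟩, Finset.filter_true_of_mem hgt, ht]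

lemma alphaSum_insert {m : ℕ} (h : Monomial m) {t : Monomial m} {F : Finset (Monomial m)}
    (ht : t ∉ F) :
    alphaSum h (insert t F) = alphaSum h F + ∑ u ∈ F, alpha (t \ h) (u \ h) := by
  have h1 : (insert t F).sym2.filter (fun p => ¬ p.IsDiag) =
      (F.sym2.filter fun p => ¬ p.IsDiag) ∪ F.image fun u => s(t, u) := by
    ext p
    induction p using Sym2.ind with
    | _ u v =>
      simp only [Finset.mem_filter, Finset.mk_mem_sym2_iff, Finset.mem_insert, Sym2.mk_isDiag_iff,
        Finset.mem_union, Finset.mem_image, Sym2.eq_iff]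
      constructor
      · rintro ⟨⟨rfl | hu, rfl | hv⟩, hne⟩
        · exact absurd rfl hne
        · exact Or.inr ⟨v, hv, Or.inl ⟨rfl, rfl⟩⟩
        · exact Or.inr ⟨u, hu, Or.inr ⟨rfl, rfl⟩⟩
        · exact Or.inl ⟨⟨hu, hv⟩, hne⟩
      · rintro (⟨⟨hu, hv⟩, hne⟩ | ⟨w, hw, ⟨rfl, rfl⟩ | ⟨rfl, rfl⟩⟩)
        · exact ⟨⟨Or.inr hu, Or.inr hv⟩, hne⟩
        · exact ⟨⟨Or.inl rfl, Or.inr hw⟩, fun e => ht (e ▸ hw)⟩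
        · exact ⟨⟨Or.inr hw, Or.inl rfl⟩, fun e => ht (e ▸ hw)⟩
  have h2 : Disjoint (F.sym2.filter fun p => ¬ p.IsDiag) (F.image fun u => s(t, u)) := by
    rw [Finset.disjoint_left]
    intro p hp hp'
    obtain ⟨u, _, rfl⟩ := Finset.mem_image.1 hp'
    rw [Finset.mem_filter, Finset.mk_mem_sym2_iff] at hp
    exact ht hp.1.1
  unfold alphaSum
  rw [h1, Finset.sum_union h2, Finset.sum_image]
  · rfl
  · intro u _ v _ huv
    exact Sym2.congr_right.1 huv

lemma lambdaIn_erase {m : ℕ} {S : Finset (Fin m)} {b : Fin m} {t : Monomial m}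
    (ht : ∀ i ∈ t, i < b) : lambdaIn S t = lambdaIn (S.erase b) t := by
  refine Finset.sum_congr rfl fun i hi => ?_
  congr 1
  ext j
  simp only [Finset.mem_filter, Finset.mem_erase]
  constructor
  · rintro ⟨h1, h2, h3⟩
    exact ⟨⟨(h2.trans (ht i hi)).ne, h1⟩, h2, h3⟩
  · rintro ⟨⟨-, h1⟩, h2⟩
    exact ⟨h1, h2⟩

lemma lambdaIn_erase_add {m : ℕ} {S : Finset (Fin m)} {a : Fin m} (ha : a ∈ S) {t : Monomial m}
    (hat : a ∉ t) : lambdaIn S t = lambdaIn (S.erase a) t + (t.filter (a < ·)).card := by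
  rw [lambdaIn, lambdaIn, Finset.card_filter, ← Finset.sum_add_distrib]
  refine Finset.sum_congr rfl fun i _ => ?_
  conv_lhs => rw [← Finset.insert_erase ha, Finset.filter_insert]
  split_ifs with h1 h2 h2
  · rw [Finset.card_insert_of_notMem (by simp)]
  · exact absurd h1.1 h2
  · exact absurd ⟨h2, hat⟩ h1
  · rfl

lemma lambdaIn_pair {m : ℕ} {S : Finset (Fin m)} {a b : Fin m} (hab : a < b)
    (hbmax : ∀ i ∈ S, i ≤ b) :
    lambdaIn S {a, b} = (S.filter (· < a)).card + ((S.erase b).erase a).card := by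
  rw [lambdaIn, Finset.sum_pair hab.ne]
  congr 2
  · ext j
    simp only [Finset.mem_filter, Finset.mem_insert, Finset.mem_singleton, not_or]
    exact ⟨fun h => ⟨h.1, h.2.1⟩, fun h => ⟨h.1, h.2, h.2.ne, (h.2.trans hab).ne⟩⟩
  · ext j
    simp only [Finset.mem_filter, Finset.mem_insert, Finset.mem_singleton, not_or,
      Finset.mem_erase]
    exact ⟨fun h => ⟨h.2.2.1, h.2.2.2, h.1⟩,
      fun h => ⟨h.2.2, lt_of_le_of_ne (hbmax j h.2.2) h.2.1, h.1, h.2.1⟩⟩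

lemma matchingWeight_insert {m : ℕ} {S : Finset (Fin m)} {a b : Fin m} (ha : a ∈ S) (hab : a < b)
    (hbmax : ∀ i ∈ S, i ≤ b) {F : Finset (Monomial m)}
    (hF : ∀ t ∈ F, t ⊆ (S.erase b).erase a ∧ t.card = 2) :
    matchingWeight S (insert {a, b} F) =
      2 ^ ((S.filter (· < a)).card + 1) * 2 ^ (((S.erase b).erase a).card + 1) *
        matchingWeight ((S.erase b).erase a) F := by
  have hta : ∀ t ∈ F, a ∉ t := fun t ht h => Finset.notMem_erase a _ ((hF t ht).1 h)
  have htb : ∀ t ∈ F, ∀ i ∈ t, i < b := fun t ht i hi => by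
    have := Finset.mem_erase.1 (Finset.mem_of_mem_erase ((hF t ht).1 hi))
    exact lt_of_le_of_ne (hbmax i this.2) this.1
  have hnot : ({a, b} : Monomial m) ∉ F := fun h => hta _ h (by simp)
  have h1 : ∀ t ∈ F, lambdaIn S t = lambdaIn ((S.erase b).erase a) t + alpha {a, b} t := by
    intro t ht
    rw [alpha_pair hab (hF t ht).2 (htb t ht) (hta t ht), lambdaIn_erase (htb t ht),
      lambdaIn_erase_add (Finset.mem_erase.2 ⟨hab.ne, ha⟩) (hta t ht)]
  rw [matchingWeight, matchingWeight, Finset.card_insert_of_notMem hnot,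
    Finset.sum_insert hnot, Finset.sum_congr rfl h1, Finset.sum_add_distrib,
    lambdaIn_pair hab hbmax, alphaSum_insert ∅ hnot]
  simp only [Finset.sdiff_empty]
  rw [mul_div_assoc',
    div_eq_div_iff (by positivity) (by positivity)]
  ring

/-- The matchings of size `μ + 1` either avoid the last variable `x_b` or arise from a matching of
size `μ` in the remaining variables by adding a pair `x_a x_b`. -/
lemma sum_matchings_succ {m : ℕ} {S : Finset (Fin m)} {J : Finset (Monomial m)}
    (hJ : IsQuadraticFamily S J) {b : Fin m} (hbmax : ∀ i ∈ S, i ≤ b) (μ : ℕ) :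
    ∑ F ∈ matchings J (μ + 1), matchingWeight S F =
      ∑ F ∈ matchings (J.filter (b ∉ ·)) (μ + 1), matchingWeight (S.erase b) F +
      ∑ a ∈ (S.erase b).filter (fun a => {a, b} ∈ J),
        2 ^ ((S.filter (· < a)).card + 1) * 2 ^ (((S.erase b).erase a).card + 1) *
          ∑ F ∈ matchings ((J.filter (b ∉ ·)).filter (a ∉ ·)) μ,
            matchingWeight ((S.erase b).erase a) F := by
  classical
  set A := (S.erase b).filter (fun a => {a, b} ∈ J) with hA
  have hAmem : ∀ a ∈ A, a ≠ b ∧ a ∈ S ∧ {a, b} ∈ J := by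
    intro a ha
    rw [hA, Finset.mem_filter, Finset.mem_erase] at ha
    exact ⟨ha.1.1, ha.1.2, ha.2⟩
  have hsub : ∀ {a}, ∀ F ∈ matchings ((J.filter (b ∉ ·)).filter (a ∉ ·)) μ, ∀ t ∈ F,
      t ∈ J ∧ b ∉ t ∧ a ∉ t ∧ t.card = 2 ∧ t ⊆ (S.erase b).erase a := by
    intro a F hF t ht
    have h1 := (mem_matchings.1 hF).1 t ht
    have h2 := hJ.filter.filter.subset t h1.1
    simp only [Finset.mem_filter] at h1
    exact ⟨h1.1.1.1, h1.1.1.2, h1.1.2, h1.2, h2⟩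
  have hunion : matchings J (μ + 1) = matchings (J.filter (b ∉ ·)) (μ + 1) ∪
      A.biUnion fun a => (matchings ((J.filter (b ∉ ·)).filter (a ∉ ·)) μ).image
        (insert {a, b}) := by
    ext F
    rw [Finset.mem_union, Finset.mem_biUnion]
    constructor
    · intro hF
      obtain ⟨h1, h2, h3⟩ := mem_matchings.1 hF
      by_cases hb : ∀ t ∈ F, b ∉ t
      · exact Or.inl (mem_matchings.2
          ⟨fun t ht => ⟨Finset.mem_filter.2 ⟨(h1 t ht).1, hb t ht⟩, (h1 t ht).2⟩, h2, h3⟩)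
      · push Not at hb
        obtain ⟨t, ht, hbt⟩ := hb
        have hc : (t.erase b).card = 1 := by rw [Finset.card_erase_of_mem hbt, (h1 t ht).2]
        obtain ⟨a, ha⟩ := Finset.card_eq_one.1 hc
        have hat : a ∈ t.erase b := ha ▸ Finset.mem_singleton_self a
        have htab : t = {a, b} := by
          rw [← Finset.insert_erase hbt, ha, Finset.pair_comm]
        have hab := Finset.mem_erase.1 hat
        subst htab
        refine Or.inr ⟨a, ?_, Finset.mem_image.2 ⟨F.erase {a, b}, ?_, Finset.insert_erase ht⟩⟩
        · exact Finset.mem_filter.2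
            ⟨Finset.mem_erase.2 ⟨hab.1, hJ.subset _ (h1 _ ht).1 hab.2⟩, (h1 _ ht).1⟩
        · refine mem_matchings.2 ⟨fun u hu => ?_, ?_, fun u hu v hv =>
            h3 u (Finset.mem_of_mem_erase hu) v (Finset.mem_of_mem_erase hv)⟩
          · obtain ⟨hne, huF⟩ := Finset.mem_erase.1 hu
            have hd := Finset.disjoint_left.1 (h3 u huF _ ht hne)
            refine ⟨Finset.mem_filter.2 ⟨Finset.mem_filter.2 ⟨(h1 u huF).1, ?_⟩, ?_⟩,
              (h1 u huF).2⟩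
            · exact fun h => hd h (by simp)
            · exact fun h => hd h (by simp)
          · rw [Finset.card_erase_of_mem ht, h2, Nat.add_sub_cancel]
    · rintro (hF | ⟨a, ha, hF⟩)
      · obtain ⟨h1, h2, h3⟩ := mem_matchings.1 hF
        exact mem_matchings.2
          ⟨fun t ht => ⟨(Finset.mem_filter.1 (h1 t ht).1).1, (h1 t ht).2⟩, h2, h3⟩
      · obtain ⟨F, hF', rfl⟩ := Finset.mem_image.1 hF
        obtain ⟨hab, -, habJ⟩ := hAmem a ha
        have hs := hsub F hF'
        obtain ⟨h1, h2, h3⟩ := mem_matchings.1 hF'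
        have hnot : ({a, b} : Monomial m) ∉ F := fun h => (hs _ h).2.2.1 (by simp)
        have hdis : ∀ t ∈ F, Disjoint {a, b} t := fun t ht => by
          simp [(hs t ht).2.1, (hs t ht).2.2.1]
        refine mem_matchings.2 ⟨fun t ht => ?_, ?_, fun t ht u hu htu => ?_⟩
        · rcases Finset.mem_insert.1 ht with rfl | ht
          · exact ⟨habJ, Finset.card_pair hab⟩
          · exact ⟨(hs t ht).1, (hs t ht).2.2.2.1⟩
        · rw [Finset.card_insert_of_notMem hnot, h2]
        · rcases Finset.mem_insert.1 ht with rfl | ht' <;>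
            rcases Finset.mem_insert.1 hu with rfl | hu'
          · exact absurd rfl htu
          · exact hdis u hu'
          · exact (hdis t ht').symm
          · exact h3 t ht' u hu' htu
  have hdisj1 : Disjoint (matchings (J.filter (b ∉ ·)) (μ + 1))
      (A.biUnion fun a => (matchings ((J.filter (b ∉ ·)).filter (a ∉ ·)) μ).image
        (insert {a, b})) := by
    rw [Finset.disjoint_left]
    intro F hF hF'
    obtain ⟨a, ha, hF'⟩ := Finset.mem_biUnion.1 hF'
    obtain ⟨F', -, rfl⟩ := Finset.mem_image.1 hF'
    have := ((mem_matchings.1 hF).1 _ (Finset.mem_insert_self _ _)).1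
    exact (Finset.mem_filter.1 this).2 (by simp)
  have hdisj2 : (A : Set (Fin m)).PairwiseDisjoint fun a =>
      (matchings ((J.filter (b ∉ ·)).filter (a ∉ ·)) μ).image (insert {a, b}) := by
    intro a ha a' ha' hne
    rw [Function.onFun, Finset.disjoint_left]
    intro F hF hF'
    obtain ⟨G, hG, rfl⟩ := Finset.mem_image.1 hF
    obtain ⟨G', hG', heq⟩ := Finset.mem_image.1 hF'
    have h1 : ({a', b} : Monomial m) ∈ insert {a, b} G := heq ▸ Finset.mem_insert_self _ _
    rcases Finset.mem_insert.1 h1 with h2 | h2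
    · have h3 : a' ∈ ({a, b} : Monomial m) := h2 ▸ (by simp)
      rcases Finset.mem_insert.1 h3 with h4 | h4
      · exact hne h4.symm
      · exact (hAmem a' (Finset.mem_coe.1 ha')).1 (Finset.mem_singleton.1 h4)
    · exact (hsub G hG _ h2).2.1 (by simp)
  rw [hunion, Finset.sum_union hdisj1, Finset.sum_biUnion hdisj2]
  congr 1
  · refine Finset.sum_congr rfl fun F hF => ?_
    rw [matchingWeight, matchingWeight]
    congr 3
    refine Finset.sum_congr rfl fun t ht => lambdaIn_erase fun i hi => ?_
    have h1 := hJ.filter.subset t ((mem_matchings.1 hF).1 t ht).1 hi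
    exact lt_of_le_of_ne (hbmax i (Finset.mem_of_mem_erase h1)) (Finset.ne_of_mem_erase h1)
  · refine Finset.sum_congr rfl fun a ha => ?_
    obtain ⟨hab, haS, -⟩ := hAmem a ha
    rw [Finset.sum_image, Finset.mul_sum]
    · refine Finset.sum_congr rfl fun F hF => ?_
      exact matchingWeight_insert haS (lt_of_le_of_ne (hbmax a haS) hab) hbmax
        fun t ht => ⟨(hsub F hF t ht).2.2.2.2, (hsub F hF t ht).2.2.2.1⟩
    · intro F hF F' hF' heq
      have hnot : ∀ F ∈ matchings ((J.filter (b ∉ ·)).filter (a ∉ ·)) μ,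
          ({a, b} : Monomial m) ∉ F := fun F hF h => (hsub F hF _ h).2.2.1 (by simp)
      rw [← Finset.erase_insert (hnot F hF), ← Finset.erase_insert (hnot F' hF')]
      exact congrArg (fun G => Finset.erase G {a, b}) heq

/-- The number of hyperbolic words with monomials in a quadratic family: both sides satisfy the
same recursion on the last variable. -/
lemma card_hyperbolicWords {m : ℕ} {S : Finset (Fin m)} : ∀ {J : Finset (Monomial m)},
    IsQuadraticFamily S J → ∀ μ : ℕ,
    ((hyperbolicWords J μ).card : ℚ) = ∑ F ∈ matchings J μ, matchingWeight S F := by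
  induction S using Finset.strongInduction with
  | H S ih =>
    intro J hJ μ
    cases μ with
    | zero =>
      have h1 : matchings J 0 = {∅} := by
        ext F
        rw [mem_matchings, Finset.mem_singleton, Finset.card_eq_zero]
        constructor
        · exact fun h => h.2.1
        · rintro rfl
          simp
      rw [hyperbolicWords_zero, h1]
      simp [matchingWeight, alphaSum]
    | succ μ =>
      rcases S.eq_empty_or_nonempty with rfl | hS
      · have h1 : matchings J (μ + 1) = ∅ := by
          refine Finset.eq_empty_of_forall_notMem fun F hF => ?_
          obtain ⟨h1, h2, -⟩ := mem_matchings.1 hF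
          obtain ⟨t, ht⟩ := Finset.card_pos.1 (by omega : 0 < F.card)
          have h3 := hJ.subset t (h1 t ht).1
          rw [Finset.subset_empty] at h3
          have h4 := (h1 t ht).2
          rw [h3, Finset.card_empty] at h4
          omega
        rw [hyperbolicWords_of_isEmpty hJ, h1]
        simp
      · have hbS : S.max' hS ∈ S := S.max'_mem hS
        have hbmax : ∀ i ∈ S, i ≤ S.max' hS := fun i hi => S.le_max' i hi
        rw [card_hyperbolicWords_succ hJ hbS hbmax, sum_matchings_succ hJ hbmax]
        push_cast
        rw [ih _ (Finset.erase_ssubset hbS) hJ.filter]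
        congr 1
        refine Finset.sum_congr rfl fun a ha => ?_
        rw [ih _ ((Finset.erase_ssubset (Finset.mem_filter.1 ha).1).trans
          (Finset.erase_ssubset hbS)) hJ.filter.filter]

/-! ### Recovering the flat from the word -/

/-- The only affine word that is `1` on the support of `q` is the constant `1`: the support of `q`
affinely spans the space. -/
def IsNondegenerate {m : ℕ} (q : Word m) : Prop :=
  ∀ y : Word m, IsAffineWord y → (∀ x, q x = 1 → y x = 1) → ∀ x, y x = 1

lemma signSum_affine {m : ℕ} {y : Word m} (hy : IsAffineWord y) :
    signSum y = 0 ∨ signSum y = 2 ^ m ∨ signSum y = -2 ^ m := by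
  by_cases hc : ∃ x, y x ≠ y 0
  · obtain ⟨a, -, z, hz, rfl⟩ := exists_lead hy.mem_univ hc
    refine Or.inl (signSum_eq_zero_of_slope (b := a) ?_)
    rw [map_add, slope_coord_self, slope_eq_zero_of_dependsOn (dependsOn_of_mem_affine hz)
      (by simp), add_zero]
  · push Not at hc
    right
    have h1 : signSum y = 2 ^ m * sgn (y 0) := by simp [signSum, hc]
    rcases zmod2_cases (y 0) with h | h
    · left; rw [h1, h]; simp [sgn]
    · right; rw [h1, h]; simp [sgn]

/-- A quadratic word supported on `y = 1`, with `y` affine, is a product of two affine words, and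
such products have sign sum `0`, `2 ^ (m - 1)` or `2 ^ m`. -/
lemma isNondegenerate_of_signSum {m : ℕ} {J : Finset (Monomial m)} (hJ : ∀ t ∈ J, t.card ≤ 2)
    {q : Word m} (hq : q ∈ code J) {μ : ℕ} (hμ : 2 ≤ μ) (hs : signSum q * 2 ^ μ = 2 ^ m) :
    IsNondegenerate q := by
  intro y hy hqy
  have hpos : (0 : ℤ) < 2 ^ m := by positivity
  have hμ' : (4 : ℤ) ≤ 2 ^ μ := by
    calc (4 : ℤ) = 2 ^ 2 := by norm_num
      _ ≤ 2 ^ μ := pow_le_pow_right₀ (by norm_num) hμ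
  have hq0 : q ≠ 0 := by
    rintro rfl
    rw [signSum_zero] at hs
    nlinarith
  by_contra hne
  push Not at hne
  obtain ⟨x₀, hx₀⟩ := hne
  have hx₀ := zmod2_ne_one.1 hx₀
  have hnc : ∃ x, y x ≠ y 0 := by
    by_contra hc
    push Not at hc
    refine hq0 (funext fun x => zmod2_ne_one.1 fun h1 => ?_)
    have h2 := hqy x h1
    rw [hc x, ← hc x₀, hx₀] at h2
    exact zero_ne_one h2
  obtain ⟨a, -, z, hz, rfl⟩ := exists_lead hy.mem_univ hnc
  have hzdep := dependsOn_of_mem_affine hz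
  have hza : ∀ x v, z (Function.update x a v) = z x :=
    fun x v => update_eq_of_dependsOn hzdep (by simp) x v
  set g := slope a q with hg
  have hgaff : IsAffineWord g := by
    refine isAffineWord_of_mem (T := Finset.univ)
      (code_mono (fun t ht => ?_) (slope_mem_code hq a))
    obtain ⟨h1, h2⟩ := mem_link.1 ht
    have h3 := hJ _ h2
    rw [Finset.card_union_of_disjoint h1, Finset.card_singleton] at h3
    exact mem_affineMonomials.2 ⟨Finset.subset_univ t, by omega⟩
  -- `q = y * g`, since `q` vanishes at one of any two points that differ in the coordinate `a`.
  have hupd : ∀ x v, q (Function.update x a v) = (v + z x) * g x := by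
    intro x v
    have hvan : ∀ v', v' + z x = 0 → q (Function.update x a v') = 0 := by
      intro v' hv'
      refine zmod2_ne_one.1 fun h1 => ?_
      have h2 := hqy _ h1
      simp only [Pi.add_apply, Function.update_self, hza, hv'] at h2
      exact zero_ne_one h2
    rw [hg, slope_apply]
    rcases zmod2_cases (z x) with h0 | h1
    · have h2 := hvan 0 (by rw [h0]; rfl)
      rcases zmod2_cases v with rfl | rfl <;> simp [h0, h2]
    · have h2 := hvan 1 (by rw [h1]; rfl)
      rcases zmod2_cases v with rfl | rfl <;> simp [h1, h2, CharTwo.add_self_eq_zero]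
  have h1 := two_mul_sum_eq a fun x => sgn (q x)
  have e : ∀ z g : ZMod 2, sgn ((1 + z) * g) + sgn ((0 + z) * g) = 1 + sgn g := by decide
  simp only [hupd, e, Finset.sum_add_distrib] at h1
  have h2 : 2 * signSum q = 2 ^ m + signSum g := by
    rw [signSum, h1, signSum]
    simp
  rcases signSum_affine hgaff with h3 | h3 | h3 <;> rw [h3] at h2 <;> nlinarith

/-- If the words `mono h * q` and `mono h' * q'`, moved by two shears, agree and `q` is
nondegenerate, then the flat of the first is contained in that of the second. -/
lemma flat_subset {m : ℕ} {h h' : Monomial m} {p p' : Fin m → Word m} (hp : p ∈ shears h)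
    (hp' : p' ∈ shears h') {q q' : Word m} (hq : DependsOn q ((h : Set (Fin m))ᶜ))
    (hnd : IsNondegenerate q)
    (H : (mono h * q) ∘ shearMap p = (mono h' * q') ∘ shearMap p') (x : Fin m → ZMod 2)
    (hx : mono h (shearMap p x) = 1) : mono h' (shearMap p' x) = 1 := by
  refine mono_eq_one_iff.2 fun l hl => ?_
  have h1 := hnd (fun x => shearMap p' (shearMap p (fillOne h x)) l)
    (((isAffineWord_shearMap hp' l).comp (isAffineWord_shearMap hp)).comp
      (isAffineWord_fillOne h)) (fun x hqx => ?_) (shearMap p x)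
  · rwa [fillOne_eq_self hx, shearMap_shearMap hp] at h1
  · have h2 := congrFun H (shearMap p (fillOne h x))
    have h3 : q (fillOne h x) = q x := hq fun j hj => fillOne_of_notMem x (by simpa using hj)
    simp only [Function.comp_apply, Pi.mul_apply, shearMap_shearMap hp, mono_fillOne, h3, hqx,
      mul_one] at h2
    have h4 : mono h' (shearMap p' (shearMap p (fillOne h x))) = 1 := by
      by_contra hne
      rw [zmod2_ne_one.1 hne, zero_mul] at h2
      exact one_ne_zero h2
    exact mono_eq_one_iff.1 h4 l hl

lemma flat_word_unique {m : ℕ} {h h' : Monomial m} {p p' : Fin m → Word m} (hp : p ∈ shears h)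
    (hp' : p' ∈ shears h') {q q' : Word m} (hq : DependsOn q ((h : Set (Fin m))ᶜ))
    (hq' : DependsOn q' ((h' : Set (Fin m))ᶜ)) (hnd : IsNondegenerate q)
    (hnd' : IsNondegenerate q')
    (H : (mono h * q) ∘ shearMap p = (mono h' * q') ∘ shearMap p') :
    h = h' ∧ p = p' ∧ q = q' := by
  obtain ⟨rfl, rfl⟩ := shear_unique hp hp' fun x =>
    ⟨flat_subset hp hp' hq hnd H x, flat_subset hp' hp hq' hnd' H.symm x⟩
  refine ⟨rfl, rfl, funext fun x => ?_⟩
  have h2 := congrFun H (shearMap p (fillOne h x))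
  have h3 : ∀ {c : Word m}, DependsOn c ((h : Set (Fin m))ᶜ) → c (fillOne h x) = c x :=
    fun hc => hc fun j hj => fillOne_of_notMem x (by simpa using hj)
  simpa only [Function.comp_apply, Pi.mul_apply, shearMap_shearMap hp, mono_fillOne, h3 hq,
    h3 hq', one_mul] using h2

/-! ### Weights -/

lemma hammingNorm_comp_shearMap {m : ℕ} {h : Monomial m} {p : Fin m → Word m}
    (hp : p ∈ shears h) (c : Word m) : hammingNorm (c ∘ shearMap p) = hammingNorm c := by
  have h1 : signSum (c ∘ shearMap p) = signSum c :=
    (Equiv.ofBijective _ (shearMap_bijective hp)).sum_comp fun x => sgn (c x)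
  rw [signSum_eq, signSum_eq] at h1
  omega

lemma hammingNorm_mono_mul {m : ℕ} {h : Monomial m} {q : Word m}
    (hq : DependsOn q ((h : Set (Fin m))ᶜ)) :
    2 ^ h.card * hammingNorm (mono h * q) = hammingNorm q := by
  induction h using Finset.induction_on with
  | empty => simp [mono_empty]
  | insert b h hb ih =>
    have hq' : DependsOn q ((h : Set (Fin m))ᶜ) := dependsOn_mono (by simp) hq
    rw [← ih hq', Finset.card_insert_of_notMem hb, pow_succ, mul_assoc]
    congr 1
    have h1 := two_mul_sum_eq b fun x => if (mono (insert b h) * q) x ≠ 0 then (1 : ℤ) else 0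
    have h2 : ∀ x v, (mono (insert b h) * q) (Function.update x b v) = v * (mono h * q) x := by
      intro x v
      rw [Pi.mul_apply, mono_update_of_mem (Finset.mem_insert_self b h),
        Finset.erase_insert hb, update_eq_of_dependsOn hq (by simp), mul_assoc]
      rfl
    simp only [h2, one_mul, zero_mul, ne_eq, not_true_eq_false, if_false, add_zero] at h1
    rw [Finset.sum_boole, Finset.sum_boole] at h1
    exact_mod_cast h1

/-- The weight of a word on a flat of codimension `r - 2` in terms of the sign sum of `q`. -/
lemma hammingNorm_flat_word_iff {m r μ : ℕ} (hr : 2 ≤ r) (hrm : r + μ ≤ m + 1)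
    {h : Monomial m} (hh : h.card = r - 2) {p : Fin m → Word m}
    (hp : p ∈ shears h) {q : Word m} (hq : DependsOn q ((h : Set (Fin m))ᶜ)) :
    hammingNorm ((mono h * q) ∘ shearMap p) = 2 ^ (m + 1 - r) - 2 ^ (m + 1 - r - μ) ↔
      signSum q * 2 ^ μ = 2 ^ m := by
  obtain ⟨s, rfl⟩ := Nat.exists_eq_add_of_le' hr
  obtain ⟨k, hk⟩ := Nat.exists_eq_add_of_le hrm
  obtain rfl : m = s + μ + k + 1 := by omega
  have e1 : s + μ + k + 1 + 1 - (s + 2) = k + μ := by omega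
  rw [hammingNorm_comp_shearMap hp, signSum_eq, ← hammingNorm_mono_mul hq, hh, e1,
    Nat.add_sub_cancel, Nat.add_sub_cancel]
  generalize hammingNorm (mono h * q) = N
  have hle : 2 ^ k ≤ 2 ^ (k + μ) := Nat.pow_le_pow_right (by norm_num) (by omega)
  rw [← Nat.cast_inj (R := ℤ), Nat.cast_sub hle]
  push_cast
  have hpos : (2 : ℤ) ^ (s + 1 + μ) ≠ 0 := by positivity
  rw [← mul_right_inj' hpos]
  constructor
  · intro H
    linear_combination -H
  · intro H
    linear_combination -H

/-! ### Words of Type II on flats in echelon form -/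

lemma ev_affineForm {m : ℕ} (a : Fin m → ZMod 2) (e : ZMod 2) (x : Fin m → ZMod 2) :
    ev (affineForm a e) x = ∑ j, a j * x j + e := by
  simp [ev, affineForm]

lemma isAffineWord_ev_affineForm {m : ℕ} (a : Fin m → ZMod 2) (e : ZMod 2) :
    IsAffineWord (ev (affineForm a e)) := by
  intro x u v
  simp only [ev_affineForm, Pi.add_apply, mul_add, Finset.sum_add_distrib]
  generalize ∑ j, a j * x j = X
  generalize ∑ j, a j * u j = U
  generalize ∑ j, a j * v j = V
  revert X U V e
  decide

lemma surjective_of_linearIndependent {m : ℕ} {ι : Type*} [Fintype ι] {a : ι → Fin m → ZMod 2}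
    (ha : LinearIndependent (ZMod 2) a) :
    Function.Surjective fun (x : Fin m → ZMod 2) i => ∑ j, a i j * x j := by
  classical
  have h1 : (Matrix.of a).rank = Fintype.card ι := LinearIndependent.rank_matrix ha
  have h2 : LinearMap.range (Matrix.of a).mulVecLin = ⊤ := by
    refine Submodule.eq_top_of_finrank_eq ?_
    rw [Module.finrank_fintype_fun_eq_card]
    exact h1
  exact LinearMap.range_eq_top.1 h2

lemma isTypeIIWith_iff {m r μ : ℕ} {c : Word m} : IsTypeIIWith r μ c ↔
    ∃ Y : Fin (r - 2) ⊕ (Fin μ × Fin 2) → Word m, IndepForms Y ∧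
      c = (∏ i, Y (Sum.inl i)) * ∑ j, Y (Sum.inr (j, 0)) * Y (Sum.inr (j, 1)) := by
  have hev : ∀ (a : Fin (r - 2) ⊕ (Fin μ × Fin 2) → (Fin m → ZMod 2))
      (e : Fin (r - 2) ⊕ (Fin μ × Fin 2) → ZMod 2),
      ev ((∏ i : Fin (r - 2), affineForm (a (Sum.inl i)) (e (Sum.inl i))) *
      ∑ j : Fin μ, affineForm (a (Sum.inr (j, 0))) (e (Sum.inr (j, 0))) *
        affineForm (a (Sum.inr (j, 1))) (e (Sum.inr (j, 1)))) =
      (∏ i, ev (affineForm (a (Sum.inl i)) (e (Sum.inl i)))) *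
        ∑ j, ev (affineForm (a (Sum.inr (j, 0))) (e (Sum.inr (j, 0)))) *
          ev (affineForm (a (Sum.inr (j, 1))) (e (Sum.inr (j, 1)))) := by
    intro a e
    funext x
    simp [ev]
  constructor
  · rintro ⟨a, e, ha, rfl⟩
    refine ⟨fun i => ev (affineForm (a i) (e i)),
      ⟨fun i => isAffineWord_ev_affineForm _ _, fun v => ?_⟩, hev a e⟩
    obtain ⟨x, hx⟩ := surjective_of_linearIndependent ha (fun i => v i + e i)
    refine ⟨x, funext fun i => ?_⟩
    have h1 := congrFun hx i
    simp only at h1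
    change ev (affineForm (a i) (e i)) x = v i
    rw [ev_affineForm, h1, add_assoc, CharTwo.add_self_eq_zero, add_zero]
  · rintro ⟨Y, ⟨hY, hsurj⟩, rfl⟩
    have hYe : ∀ i, ev (affineForm (fun j => Y i (Pi.single j 1) + Y i 0) (Y i 0)) = Y i := by
      intro i
      funext x
      rw [ev_affineForm, (hY i).eq_sum x, add_comm]
      congr 1
      exact Finset.sum_congr rfl fun j _ => mul_comm _ _
    refine ⟨fun i j => Y i (Pi.single j 1) + Y i 0, fun i => Y i 0, ?_, ?_⟩
    · rw [Fintype.linearIndependent_iff]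
      intro g hg k
      obtain ⟨x, hx⟩ := hsurj fun i => Y i 0 + if i = k then 1 else 0
      have hval : ∀ i, ∑ j, (Y i (Pi.single j 1) + Y i 0) * x j = if i = k then 1 else 0 := by
        intro i
        have h1 := congrFun (hYe i) x
        rw [ev_affineForm, show Y i x = _ from congrFun hx i, add_comm] at h1
        exact add_left_cancel h1
      have h2 : ∑ j, (∑ i, g i • fun j => Y i (Pi.single j 1) + Y i 0) j * x j = 0 := by
        rw [hg]; simp
      simp only [Finset.sum_apply, Pi.smul_apply, smul_eq_mul, Finset.sum_mul, mul_assoc] at h2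
      rw [Finset.sum_comm] at h2
      simpa only [← Finset.mul_sum, hval, mul_ite, mul_one, mul_zero, Finset.sum_ite_eq',
        Finset.mem_univ, if_true] using h2
    · have h1 := hev (fun i j => Y i (Pi.single j 1) + Y i 0) fun i => Y i 0
      simp only [hYe] at h1
      exact h1.symm

lemma IndepForms.comp_equiv {m : ℕ} {ι κ : Type*} {Y : ι → Word m} (hY : IndepForms Y)
    (e : κ ≃ ι) : IndepForms fun k => Y (e k) := by
  refine ⟨fun k => hY.1 _, fun v => ?_⟩
  obtain ⟨x, hx⟩ := hY.2 fun i => v (e.symm i)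
  refine ⟨x, funext fun k => ?_⟩
  have := congrFun hx (e k)
  simpa using this

/-- The coordinates in `h` together with affine words that are jointly surjective in the other
coordinates are independent, also after a shear. -/
lemma indepForms_flat {m : ℕ} {h : Monomial m} {p : Fin m → Word m} (hp : p ∈ shears h)
    {κ : Type*} {Y : κ → Word m} (hY : ∀ i, IsAffineWord (Y i))
    (hsurj : ∀ (v : κ → ZMod 2) (x : Fin m → ZMod 2),
      ∃ x', (∀ j ∈ h, x' j = x j) ∧ ∀ i, Y i x' = v i) :
    IndepForms (Sum.elim (fun (l : h) x => shearMap p x l) fun i x => Y i (shearMap p x)) := by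
  classical
  refine ⟨?_, fun v => ?_⟩
  · rintro (l | i)
    · exact isAffineWord_shearMap hp l
    · exact (hY i).comp (isAffineWord_shearMap hp)
  · obtain ⟨x, hx1, hx2⟩ := hsurj (fun i => v (Sum.inr i))
      (fun j => if hj : j ∈ h then v (Sum.inl ⟨j, hj⟩) else 0)
    refine ⟨shearMap p x, funext ?_⟩
    rintro (l | i)
    · simp only [Sum.elim_inl, shearMap_shearMap hp]
      rw [hx1 l l.2, dif_pos l.2]
    · simp only [Sum.elim_inr, shearMap_shearMap hp, hx2]

/-- A Type II word in a decreasing code is, up to a shear, a monomial of degree `r - 2` times a word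
in the remaining variables. -/
lemma exists_flat_word {m r ν : ℕ} {I : Finset (Monomial m)} (hI : IsDecreasing I) {c : Word m}
    (hc : c ∈ code I) (hII : IsTypeIIWith r ν c) :
    ∃ h : Monomial m, h.card = r - 2 ∧ ∃ p ∈ shears h, ∃ q ∈ code (link I h),
      DependsOn q ((h : Set (Fin m))ᶜ) ∧ c = (mono h * q) ∘ shearMap p := by
  obtain ⟨Y, hY, rfl⟩ := isTypeIIWith_iff.1 hII
  obtain ⟨h, p, hp, hcard, hprod⟩ := exists_echelon hY (Finset.univ.map ⟨_, Sum.inl_injective⟩)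
  simp only [Finset.card_map, Finset.card_univ, Fintype.card_fin] at hcard
  simp only [Finset.prod_map, Function.Embedding.coeFn_mk] at hprod
  set Q : Word m := ∑ j, Y (Sum.inr (j, 0)) * Y (Sum.inr (j, 1)) with hQ
  set q : Word m := fun x => Q (shearMap p (fillOne h x)) with hq
  have hqdep : DependsOn q ((h : Set (Fin m))ᶜ) := by
    intro x y hxy
    have : fillOne h x = fillOne h y := by
      funext i
      by_cases hi : i ∈ h
      · rw [fillOne_of_mem _ hi, fillOne_of_mem _ hi]
      · rw [fillOne_of_notMem _ hi, fillOne_of_notMem _ hi, hxy i (by simpa using hi)]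
    simp only [hq, this]
  have heq : (∏ i, Y (Sum.inl i)) * Q = (mono h * q) ∘ shearMap p := by
    funext x
    simp only [Pi.mul_apply, Finset.prod_apply, hprod, Function.comp_apply]
    rcases zmod2_cases (mono h (shearMap p x)) with h0 | h1
    · rw [h0, zero_mul, zero_mul]
    · simp only [hq]
      rw [fillOne_eq_self h1, shearMap_shearMap hp]
  rw [heq, comp_shearMap_mem_code_iff hI hp] at hc
  exact ⟨h, hcard, p, hp, q, mem_code_link hqdep hc, hqdep, heq⟩

lemma prod_shearMap_equiv {m : ℕ} {κ : Type*} [Fintype κ] {h : Monomial m} (e : κ ≃ h)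
    (x : Fin m → ZMod 2) : ∏ k, x (e k) = mono h x := by
  rw [Equiv.prod_comp e fun l : h => x l]
  exact Finset.prod_coe_sort h x

lemma mem_of_mem_link {m : ℕ} {I : Finset (Monomial m)} (hI : IsDecreasing I) {h t : Monomial m}
    (ht : t ∈ link I h) : h ∈ I :=
  hI.mem_of_dominated (mem_link.1 ht).2 (.of_subset Finset.subset_union_left)

lemma isQuadraticFamily_link {m r : ℕ} {I : Finset (Monomial m)} (hI : IsDecreasing I)
    (hr : ∀ f ∈ I, f.card ≤ r) {h : Monomial m} (hh : h.card = r - 2) :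
    IsQuadraticFamily hᶜ (link I h) where
  subset t ht := by
    rw [Finset.subset_compl_iff_disjoint_right]
    exact (mem_link.1 ht).1.symm
  card_le t ht := by
    obtain ⟨h1, h2⟩ := mem_link.1 ht
    have h3 := hr _ h2
    rw [Finset.card_union_of_disjoint h1] at h3
    omega
  closed t ht t' ht' hd := by
    obtain ⟨h1, h2⟩ := mem_link.1 ht
    refine mem_link.2 ⟨?_, hI.mem_of_dominated h2 (hd.union_left h1)⟩
    rw [disjoint_comm, ← Finset.subset_compl_iff_disjoint_right]
    exact ht'

lemma dependsOn_of_mem_link {m : ℕ} {I : Finset (Monomial m)} {h : Monomial m} {q : Word m}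
    (hq : q ∈ code (link I h)) : DependsOn q ((h : Set (Fin m))ᶜ) := by
  have h1 := dependsOn_of_mem_code (T := hᶜ) (fun t ht => by
    rw [Finset.subset_compl_iff_disjoint_right]
    exact (mem_link.1 ht).1.symm) hq
  simpa using h1

/-- For `h` of degree `r - 2`, the words `mono h * q` with `q` hyperbolic are of Type II, also after
a shear. -/
lemma isTypeIIWith_flat_word {m r μ : ℕ} {I : Finset (Monomial m)} (hI : IsDecreasing I)
    (hr : ∀ f ∈ I, f.card ≤ r) {h : Monomial m} (hh : h.card = r - 2) {p : Fin m → Word m}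
    (hp : p ∈ shears h) {q : Word m} (hq : q ∈ hyperbolicWords (link I h) μ) :
    IsTypeIIWith r μ ((mono h * q) ∘ shearMap p) := by
  obtain ⟨Y, h1, -, h3, rfl⟩ := exists_hyperbolic_form (isQuadraticFamily_link hI hr hh) hq
  have hZ := indepForms_flat hp h1 fun v x => by
    obtain ⟨x', hx1, hx2⟩ := h3 v x
    exact ⟨x', fun j hj => hx1 j (by simpa using hj), hx2⟩
  have e : Fin (r - 2) ≃ h := (Fintype.equivFinOfCardEq (by rw [Fintype.card_coe, hh])).symm
  refine isTypeIIWith_iff.2 ⟨_, hZ.comp_equiv (Equiv.sumCongr e (Equiv.refl _)), ?_⟩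
  funext x
  simp [prod_shearMap_equiv e]

/-- For `f` of degree `r`, the indicator of a flat with pivot set `f` is of Type II. -/
lemma isTypeIIWith_one_flat {m r : ℕ} (hr : 2 ≤ r) {f : Monomial m} (hf : f.card = r)
    {p : Fin m → Word m} (hp : p ∈ shears f) : IsTypeIIWith r 1 (mono f ∘ shearMap p) := by
  have hZ : IndepForms fun (l : f) x => shearMap p x l :=
    (indepForms_flat hp (κ := Empty) (Y := Empty.elim) (fun i => i.elim)
      fun v x => ⟨x, fun _ _ => rfl, fun i => i.elim⟩).comp_equiv
        (Equiv.sumEmpty f Empty).symm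
  have e : Fin (r - 2) ⊕ (Fin 1 × Fin 2) ≃ f := Fintype.equivOfCardEq (by simp [hf]; omega)
  refine isTypeIIWith_iff.2 ⟨_, hZ.comp_equiv e, ?_⟩
  funext x
  rw [Function.comp_apply, ← prod_shearMap_equiv e, Fintype.prod_sum_type,
    Fintype.prod_prod_type]
  simp

/-- For `μ = 1` the word `q` is a product of two affine forms, so that `mono h * q` is the indicator
of a flat of codimension `r`. -/
lemma exists_flat_indicator {m r : ℕ} (hr2 : 2 ≤ r) {I : Finset (Monomial m)}
    (hI : IsDecreasing I) (hr : ∀ f ∈ I, f.card ≤ r) {h : Monomial m} (hh : h.card = r - 2)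
    {p : Fin m → Word m} (hp : p ∈ shears h) {q : Word m}
    (hq : q ∈ hyperbolicWords (link I h) 1) :
    ∃ f ∈ degPart I r, ∃ p' ∈ shears f, (mono h * q) ∘ shearMap p = mono f ∘ shearMap p' := by
  have hcode : (mono h * q) ∘ shearMap p ∈ code I :=
    comp_shearMap_mem_code hI hp (mono_mul_mem_code (mem_hyperbolicWords.1 hq).1)
  obtain ⟨Y, h1, -, h3, rfl⟩ := exists_hyperbolic_form (isQuadraticFamily_link hI hr hh) hq
  have hZ := indepForms_flat hp h1 fun v x => by
    obtain ⟨x', hx1, hx2⟩ := h3 v x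
    exact ⟨x', fun j hj => hx1 j (by simpa using hj), hx2⟩
  obtain ⟨f, p', hp', hcard, hprod⟩ := exists_echelon hZ Finset.univ
  have heq : (mono h * ∑ j, Y (j, 0) * Y (j, 1)) ∘ shearMap p = mono f ∘ shearMap p' := by
    funext x
    rw [Function.comp_apply, Function.comp_apply, ← hprod, Fintype.prod_sum_type,
      Fintype.prod_prod_type]
    simp only [Sum.elim_inl, Sum.elim_inr, Pi.mul_apply, Finset.univ_unique,
      Finset.sum_singleton, Finset.prod_singleton, Fin.prod_univ_two]
    rw [← prod_shearMap_equiv (Equiv.refl h)]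
    rfl
  have hf : f ∈ I := by
    rw [heq, comp_shearMap_mem_code_iff hI hp', ← mul_one (mono f)] at hcode
    obtain ⟨t, ht⟩ := nonempty_of_mem_code (mem_code_link (fun _ _ _ => rfl) hcode) one_ne_zero
    exact mem_of_mem_link hI ht
  refine ⟨f, Finset.mem_filter.2 ⟨hf, ?_⟩, p', hp', heq⟩
  rw [hcard]
  simp [hh]
  omega

/-! ### The two counts -/

lemma lambdaSize_union {m : ℕ} {h t : Monomial m} (hd : Disjoint h t) :
    lambdaSize (h ∪ t) ((h ∪ t) \ h) = lambdaIn hᶜ t := by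
  rw [Finset.union_sdiff_cancel_left hd]
  refine Finset.sum_congr rfl fun i _ => ?_
  rw [lambdaVar]
  congr 1
  ext j
  simp only [Finset.mem_filter, Finset.mem_univ, true_and, Finset.mem_union, Finset.mem_compl]
  tauto

lemma union_injOn {m : ℕ} {h : Monomial m} {F : Finset (Monomial m)}
    (hF : ∀ t ∈ F, Disjoint h t) : Set.InjOn (h ∪ ·) (F : Set (Monomial m)) := by
  intro t ht u hu htu
  have h1 := congrArg (· \ h) htu
  simp only at h1
  rwa [Finset.union_sdiff_cancel_left (hF t ht), Finset.union_sdiff_cancel_left (hF u hu)] at h1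

lemma alphaSum_image_union {m : ℕ} {h : Monomial m} {F : Finset (Monomial m)}
    (hF : ∀ t ∈ F, Disjoint h t) : alphaSum h (F.image (h ∪ ·)) = alphaSum ∅ F := by
  induction F using Finset.induction_on with
  | empty => simp [alphaSum]
  | insert t F ht ih =>
    have hF' : ∀ u ∈ F, Disjoint h u := fun u hu => hF u (Finset.mem_insert_of_mem hu)
    have htd := hF t (Finset.mem_insert_self t F)
    have hnot : h ∪ t ∉ F.image (h ∪ ·) := by
      intro hmem
      obtain ⟨u, hu, heq⟩ := Finset.mem_image.1 hmem
      have := union_injOn hF (Finset.mem_coe.2 (Finset.mem_insert_of_mem hu))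
        (Finset.mem_coe.2 (Finset.mem_insert_self t F)) heq
      exact ht (this ▸ hu)
    rw [Finset.image_insert, alphaSum_insert h hnot, ih hF', alphaSum_insert ∅ ht,
      Finset.sum_image (union_injOn hF')]
    congr 1
    refine Finset.sum_congr rfl fun u hu => ?_
    rw [Finset.union_sdiff_cancel_left htd, Finset.union_sdiff_cancel_left (hF' u hu),
      Finset.sdiff_empty, Finset.sdiff_empty]

/-- Matchings in the link of `h` correspond to the sets of monomials of degree `r` with pairwise
greatest common divisor `h`. -/
lemma sum_tuplesWithGcd {m r μ : ℕ} (hr : 2 ≤ r) (hμ : 2 ≤ μ) {I : Finset (Monomial m)}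
    {h : Monomial m} (hh : h.card = r - 2) :
    ∑ F ∈ tuplesWithGcd I r μ h,
        (2 : ℚ) ^ (r - 2 + 2 * μ + lambdaSize h h + ∑ f ∈ F, lambdaSize f (f \ h)) /
          (2 : ℚ) ^ alphaSum h F =
      2 ^ (r - 2 + lambdaSize h h) *
        ∑ F ∈ matchings (link I h) μ, matchingWeight hᶜ F := by
  classical
  rw [Finset.mul_sum]
  symm
  have hmat : ∀ F ∈ matchings (link I h) μ, ∀ t ∈ F, Disjoint h t := fun F hF t ht =>
    (mem_link.1 ((mem_matchings.1 hF).1 t ht).1).1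
  have hmem : ∀ F, F ∈ tuplesWithGcd I r μ h ↔ (∀ f ∈ F, f ∈ I ∧ f.card = r) ∧ F.card = μ ∧
      ∀ f ∈ F, ∀ g ∈ F, f ≠ g → f ∩ g = h := by
    intro F
    simp only [tuplesWithGcd, degPart, Finset.mem_filter, Finset.mem_powersetCard,
      Finset.subset_iff, and_assoc]
  have hsub : ∀ F ∈ tuplesWithGcd I r μ h, ∀ f ∈ F, h ⊆ f := by
    intro F hF f hf
    obtain ⟨-, h2, h3⟩ := (hmem F).1 hF
    obtain ⟨g, hg, hne⟩ := Finset.exists_mem_ne (by omega : 1 < F.card) f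
    rw [← h3 f hf g hg hne.symm]
    exact Finset.inter_subset_left
  refine Finset.sum_nbij' (fun F => F.image (h ∪ ·)) (fun F => F.image (· \ h)) ?_ ?_ ?_ ?_ ?_
  · intro F hF
    obtain ⟨h1, h2, h3⟩ := mem_matchings.1 hF
    refine (hmem _).2 ⟨fun f hf => ?_, ?_, fun f hf g hg hne => ?_⟩
    · obtain ⟨t, ht, rfl⟩ := Finset.mem_image.1 hf
      refine ⟨(mem_link.1 (h1 t ht).1).2, ?_⟩
      rw [Finset.card_union_of_disjoint (hmat F hF t ht), hh, (h1 t ht).2]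
      omega
    · rw [Finset.card_image_of_injOn (union_injOn (hmat F hF)), h2]
    · obtain ⟨t, ht, rfl⟩ := Finset.mem_image.1 hf
      obtain ⟨u, hu, rfl⟩ := Finset.mem_image.1 hg
      have hd := h3 t ht u hu fun e => hne (e ▸ rfl)
      rw [← Finset.union_inter_distrib_left, Finset.disjoint_iff_inter_eq_empty.1 hd,
        Finset.union_empty]
  · intro F hF
    obtain ⟨h1, h2, h3⟩ := (hmem F).1 hF
    have hs := hsub F hF
    refine mem_matchings.2 ⟨fun t ht => ?_, ?_, fun t ht u hu hne => ?_⟩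
    · obtain ⟨f, hf, rfl⟩ := Finset.mem_image.1 ht
      refine ⟨mem_link.2 ⟨Finset.disjoint_sdiff, ?_⟩, ?_⟩
      · rw [Finset.union_sdiff_of_subset (hs f hf)]
        exact (h1 f hf).1
      · rw [Finset.card_sdiff_of_subset (hs f hf), (h1 f hf).2, hh]
        omega
    · rw [Finset.card_image_of_injOn, h2]
      intro f hf g hg hfg
      simp only at hfg
      rw [← Finset.union_sdiff_of_subset (hs f hf), hfg,
        Finset.union_sdiff_of_subset (hs g hg)]
    · obtain ⟨f, hf, rfl⟩ := Finset.mem_image.1 ht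
      obtain ⟨g, hg, rfl⟩ := Finset.mem_image.1 hu
      have hfg := h3 f hf g hg fun e => hne (e ▸ rfl)
      rw [Finset.disjoint_left]
      intro i hi hi'
      rw [Finset.mem_sdiff] at hi hi'
      exact hi.2 (hfg ▸ Finset.mem_inter.2 ⟨hi.1, hi'.1⟩)
  · intro F hF
    rw [Finset.image_image]
    refine (Finset.image_congr fun t ht => ?_).trans Finset.image_id
    simp [Finset.union_sdiff_cancel_left (hmat F hF t ht)]
  · intro F hF
    rw [Finset.image_image]
    refine (Finset.image_congr fun f hf => ?_).trans Finset.image_id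
    simp [Finset.union_sdiff_of_subset (hsub F hF f hf)]
  · intro F hF
    rw [alphaSum_image_union (hmat F hF), Finset.sum_image (union_injOn (hmat F hF)),
      Finset.sum_congr rfl fun t ht => lambdaSize_union (hmat F hF t ht), matchingWeight,
      (mem_matchings.1 hF).2.1, mul_div_assoc']
    congr 1
    ring

/-- The Type II words for `μ ≥ 2`, fibred over the flats they live on. -/
lemma ncard_typeIICodewords {m r μ : ℕ} {I : Finset (Monomial m)} (hI : IsDecreasing I)
    (hr : ∀ f ∈ I, f.card ≤ r) (hr2 : 2 ≤ r) (hrm : r ≤ m) (hμ : 2 ≤ μ)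
    (hμ2 : 2 * μ ≤ m - r + 2) :
    (typeIICodewords I r (2 ^ (m + 1 - r) - 2 ^ (m + 1 - r - μ))).ncard =
      ∑ h ∈ degPart I (r - 2),
        2 ^ (r - 2 + lambdaSize h h) * (hyperbolicWords (link I h) μ).card := by
  classical
  set G : Monomial m → (Fin m → Word m) × Word m → Word m :=
    fun h d => (mono h * d.2) ∘ shearMap d.1 with hG
  have hT : typeIICodewords I r (2 ^ (m + 1 - r) - 2 ^ (m + 1 - r - μ)) =
      (((degPart I (r - 2)).biUnion fun h =>
        (shears h ×ˢ hyperbolicWords (link I h) μ).image (G h) : Finset (Word m)) :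
          Set (Word m)) := by
    ext c
    simp only [typeIICodewords, Set.mem_ofPred_eq, Finset.coe_biUnion, Finset.mem_coe,
      Set.mem_iUnion, Finset.mem_image, Finset.mem_product, Prod.exists, exists_prop]
    constructor
    · rintro ⟨hc, hw, ν, -, -, hII⟩
      obtain ⟨h, hh, p, hp, q, hq, hqdep, rfl⟩ := exists_flat_word hI hc hII
      have hs := (hammingNorm_flat_word_iff hr2 (by omega) hh hp hqdep).1 hw
      refine ⟨h, ?_, p, q, ⟨hp, mem_hyperbolicWords.2 ⟨hq, hs⟩⟩, rfl⟩
      have hq0 : q ≠ 0 := by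
        rintro rfl
        rw [signSum_zero] at hs
        have h1 : (0 : ℤ) < 2 ^ m := by positivity
        have h2 : (2 : ℤ) ^ μ = 1 := by
          refine mul_left_cancel₀ h1.ne' ?_
          rw [hs, mul_one]
        have h3 : (1 : ℤ) < 2 ^ μ := one_lt_pow₀ (by norm_num) (by omega)
        omega
      obtain ⟨t, ht⟩ := nonempty_of_mem_code hq hq0
      exact Finset.mem_filter.2 ⟨mem_of_mem_link hI ht, hh⟩
    · rintro ⟨h, hh, p, q, ⟨hp, hq⟩, rfl⟩
      have hcard := (Finset.mem_filter.1 hh).2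
      obtain ⟨hqJ, hs⟩ := mem_hyperbolicWords.1 hq
      refine ⟨comp_shearMap_mem_code hI hp (mono_mul_mem_code hqJ), ?_, μ, by omega, hμ2,
        isTypeIIWith_flat_word hI hr hcard hp hq⟩
      exact (hammingNorm_flat_word_iff hr2 (by omega) hcard hp (dependsOn_of_mem_link hqJ)).2 hs
  have huniq : ∀ h ∈ degPart I (r - 2), ∀ h' ∈ degPart I (r - 2),
      ∀ d ∈ shears h ×ˢ hyperbolicWords (link I h) μ,
      ∀ d' ∈ shears h' ×ˢ hyperbolicWords (link I h') μ, G h d = G h' d' → h = h' ∧ d = d' := by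
    have hnd : ∀ h ∈ degPart I (r - 2), ∀ q ∈ hyperbolicWords (link I h) μ,
        IsNondegenerate q := by
      intro h hh q hq
      obtain ⟨hqJ, hs⟩ := mem_hyperbolicWords.1 hq
      exact isNondegenerate_of_signSum
        (isQuadraticFamily_link hI hr (Finset.mem_filter.1 hh).2).card_le hqJ hμ hs
    rintro h hh h' hh' ⟨p, q⟩ hd ⟨p', q'⟩ hd' heq
    rw [Finset.mem_product] at hd hd'
    obtain ⟨h1, h2, h3⟩ := flat_word_unique hd.1 hd'.1
      (dependsOn_of_mem_link (mem_hyperbolicWords.1 hd.2).1)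
      (dependsOn_of_mem_link (mem_hyperbolicWords.1 hd'.2).1)
      (hnd h hh q hd.2) (hnd h' hh' q' hd'.2) heq
    exact ⟨h1, Prod.ext h2 h3⟩
  rw [hT, Set.ncard_coe_finset, Finset.card_biUnion]
  · refine Finset.sum_congr rfl fun h hh => ?_
    rw [Finset.card_image_of_injOn, Finset.card_product, card_shears,
      (Finset.mem_filter.1 hh).2]
    intro d hd d' hd' heq
    exact (huniq h hh h hh d hd d' hd' heq).2
  · intro h hh h' hh' hne
    rw [Function.onFun, Finset.disjoint_left]
    intro c hc hc'
    obtain ⟨d, hd, rfl⟩ := Finset.mem_image.1 hc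
    obtain ⟨d', hd', heq⟩ := Finset.mem_image.1 hc'
    exact hne (huniq h hh h' hh' d hd d' hd' heq.symm).1

/-- The Type II words of the least weight, which are the indicators of flats of codimension `r`. -/
lemma ncard_typeIICodewords_one {m r : ℕ} {I : Finset (Monomial m)} (hI : IsDecreasing I)
    (hr : ∀ f ∈ I, f.card ≤ r) (hr2 : 2 ≤ r) (hrm : r ≤ m) :
    (typeIICodewords I r (2 ^ (m + 1 - r) - 2 ^ (m + 1 - r - 1))).ncard =
      ∑ f ∈ degPart I r, 2 ^ (r + lambdaSize f f) := by
  classical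
  have hT : typeIICodewords I r (2 ^ (m + 1 - r) - 2 ^ (m + 1 - r - 1)) =
      (((degPart I r).biUnion fun f => (shears f).image fun p => mono f ∘ shearMap p :
        Finset (Word m)) : Set (Word m)) := by
    ext c
    simp only [typeIICodewords, Set.mem_ofPred_eq, Finset.coe_biUnion, Finset.mem_coe,
      Set.mem_iUnion, Finset.mem_image, exists_prop]
    constructor
    · rintro ⟨hc, hw, ν, -, -, hII⟩
      obtain ⟨h, hh, p, hp, q, hq, hqdep, rfl⟩ := exists_flat_word hI hc hII
      have hs := (hammingNorm_flat_word_iff hr2 (by omega) hh hp hqdep).1 hw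
      obtain ⟨f, hf, p', hp', heq⟩ := exists_flat_indicator hr2 hI hr hh hp
        (mem_hyperbolicWords.2 ⟨hq, hs⟩)
      exact ⟨f, hf, p', hp', heq.symm⟩
    · rintro ⟨f, hf, p, hp, rfl⟩
      obtain ⟨hfI, hcard⟩ := Finset.mem_filter.1 hf
      refine ⟨comp_shearMap_mem_code hI hp (mono_mem_code hfI), ?_, 1, by omega, by omega,
        isTypeIIWith_one_flat hr2 hcard hp⟩
      have h1 := hammingNorm_mono_mul (h := f) (q := 1) fun _ _ _ => rfl
      have h2 : hammingNorm (1 : Word m) = 2 ^ m := by simp [hammingNorm]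
      rw [mul_one, h2, hcard] at h1
      rw [hammingNorm_comp_shearMap hp]
      obtain ⟨k, rfl⟩ := Nat.exists_eq_add_of_le hrm
      have e1 : r + k + 1 - r = k + 1 := by omega
      rw [e1, Nat.add_sub_cancel, pow_succ, mul_two, Nat.add_sub_cancel]
      rw [pow_add] at h1
      exact Nat.eq_of_mul_eq_mul_left (by positivity) h1
  have huniq : ∀ f f' : Monomial m, ∀ p ∈ shears f, ∀ p' ∈ shears f',
      mono f ∘ shearMap p = mono f' ∘ shearMap p' → f = f' ∧ p = p' := by
    intro f f' p hp p' hp' heq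
    exact shear_unique hp hp' fun x => by
      have h1 := congrFun heq x
      simp only [Function.comp_apply] at h1
      rw [h1]
  rw [hT, Set.ncard_coe_finset, Finset.card_biUnion]
  · refine Finset.sum_congr rfl fun f hf => ?_
    rw [Finset.card_image_of_injOn, card_shears, (Finset.mem_filter.1 hf).2]
    intro p hp p' hp' heq
    exact (huniq f f p hp p' hp' heq).2
  · intro f hf f' hf' hne
    rw [Function.onFun, Finset.disjoint_left]
    intro c hc hc'
    obtain ⟨p, hp, rfl⟩ := Finset.mem_image.1 hc
    obtain ⟨p', hp', heq⟩ := Finset.mem_image.1 hc'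
    exact hne (huniq f f' p hp p' hp' heq.symm).1

end PolarCode

theorem mainTheorem1 (m r μ : ℕ) (I : Finset (PolarCode.Monomial m))
    (hI : PolarCode.IsDecreasing I)
    (hr : IsGreatest {d : ℕ | ∃ f ∈ I, f.card = d} r) (hr2 : 2 ≤ r)
    (hμ1 : 2 ≤ 2 * μ) (hμ2 : 2 * μ ≤ m - r + 2) :
    (2 ≤ μ →
      ((PolarCode.typeIICodewords I r
          (2 ^ (m + 1 - r) - 2 ^ (m + 1 - r - μ))).ncard : ℚ) =
        ∑ h ∈ PolarCode.degPart I (r - 2), ∑ F ∈ PolarCode.tuplesWithGcd I r μ h,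
          (2 : ℚ) ^ (r - 2 + 2 * μ + PolarCode.lambdaSize h h +
              ∑ f ∈ F, PolarCode.lambdaSize f (f \ h)) /
            (2 : ℚ) ^ PolarCode.alphaSum h F) ∧
    (μ = 1 →
      (PolarCode.typeIICodewords I r
          (2 ^ (m + 1 - r) - 2 ^ (m + 1 - r - μ))).ncard =
        ∑ f ∈ PolarCode.degPart I r, 2 ^ (r + PolarCode.lambdaSize f f)) := by
  have hmax : ∀ f ∈ I, f.card ≤ r := fun f hf => hr.2 ⟨f, hf, rfl⟩
  have hrm : r ≤ m := by
    obtain ⟨f, -, hf⟩ := hr.1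
    rw [← hf]
    exact card_finset_fin_le f
  refine ⟨fun hμ => ?_, ?_⟩
  · rw [PolarCode.ncard_typeIICodewords hI hmax hr2 hrm hμ hμ2]
    push_cast
    refine Finset.sum_congr rfl fun h hh => ?_
    have hcard := (Finset.mem_filter.1 hh).2
    rw [PolarCode.sum_tuplesWithGcd hr2 hμ hcard, PolarCode.card_hyperbolicWords
      (PolarCode.isQuadraticFamily_link hI hmax hcard)]
  · rintro rfl
    exact PolarCode.ncard_typeIICodewords_one hI hmax hr2 hrm
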